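/- A convex body in the plane is a compact convex set $C\subset\mathbb{R}^2$ with non-empty interior. Call $C$ a regular symmetric body if moreover $-C=C$, every boundary point of $C$ lies on exactly one tangent (supporting) line of $C$ (smoothness), and every tangent line of $C$ meets $C$ in a single point (strict convexity). Put $\|x\|_C=\inf\{\lambda>0: x\in\lambda C\}$ and $\|z\|_C^*=\sup_{y\in C}|z\cdot y|$, and let $\varphi_C(x)$ be the unique support of $x$, i.e. the unique $z\in\mathbb{R}^2$ with $z\cdot x=\|x\|_C^2$ and $\|z\|_C^*=\|x\|_C$. For a finite set $V$, $p:V\to\mathbb{R}^2$ and $r:V\to\mathbb{R}_{>0}$, a triple $P=(G,p,r)$ is a $C$-packing if the homothetic copies $C_v=r_vC+p_v$ $(v\in V)$ have pairwise disjoint interiors and $G=(V,E)$ is their contact graph, i.e. distinct $v,w\in V$ are adjacent if and only if $C_v\cap C_w\neq\emptyset$. The pair $(G,p)$ is its contact framework; it is well-positioned if $\|p_v-p_w\|_C>0$ for all $vw\in E$ and the map $q\mapsto(\tfrac12\|q_v-q_w\|_C^2)_{vw\in E}$ is differentiable at $p$. An edge-length equilibrium stress of $(G,p)$ is a map $a:E\to\mathbb{R}$,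 not identically zero, such that for every $v\in V$ $$\sum_{w\in N(v)}a_{vw}\,\varphi_C(p_v-p_w)=0,\qquad \sum_{w\in N(v)}a_{vw}\,\|p_v-p_w\|_C=0 .$$ The packing rigidity matrix $R_C(G,p,r)$ is the $|E|\times 3|V|$ matrix whose row indexed by $vw\in E$ has entry $[\varphi_C(p_v-p_w)]_i$ in column $(v,i)$, $[\varphi_C(p_w-p_v)]_i$ in column $(w,i)$ $(i=1,2)$, $-(r_v+r_w)$ in each of the columns $v$ and $w$ of the last $|V|$ columns, and $0$ elsewhere. **Lemma 3.2.** Let $C$ be a regular symmetric body in the plane and let $P=(G,p,r)$ be a $C$-packing. Then the contact framework $(G,p)$ is well-positioned and has no edge-length equilibrium stress, and the packing rigidity matrix $R_C(G,p,r)$ has full row rank: $\operatorname{rank}R_C(G,p,r)=|E|$. -/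

import Mathlib

open scoped RealInnerProductSpace

noncomputable section

namespace SymPacking

variable {d : ℕ}

/-- A convex body: a compact convex subset of `ℝ^d` with non-empty interior. -/
structure IsConvexBody (C : Set (EuclideanSpace ℝ (Fin d))) : Prop where
  isCompact : IsCompact C
  convex : Convex ℝ C
  interior_nonempty : (interior C).Nonempty

/-- `H` is a tangent (supporting) hyperplane of `C`: an affine hyperplane that meets `C` and has
`C` on one of its closed sides. -/
def IsTangentHyperplane (C H : Set (EuclideanSpace ℝ (Fin d))) : Prop :=
  ∃ (z : EuclideanSpace ℝ (Fin d)) (c : ℝ), z ≠ 0 ∧ H = {y | ⟪z, y⟫ = c} ∧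
    (∀ y ∈ C, ⟪z, y⟫ ≤ c) ∧ (H ∩ C).Nonempty

/-- A regular symmetric body: a centrally symmetric convex body that is smooth (every boundary
point lies on exactly one tangent hyperplane) and strictly convex (every tangent hyperplane meets
the body in a single point). -/
structure IsRegularSymmetricBody (C : Set (EuclideanSpace ℝ (Fin d))) : Prop
    extends IsConvexBody C where
  symmetric : ∀ x ∈ C, -x ∈ C
  smooth : ∀ x ∈ frontier C, ∃! H : Set (EuclideanSpace ℝ (Fin d)),
    IsTangentHyperplane C H ∧ x ∈ H
  strictlyConvex : ∀ H : Set (EuclideanSpace ℝ (Fin d)), IsTangentHyperplane C H →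
    ∃ x, H ∩ C = {x}

/-- The norm `‖x‖_C = inf {t > 0 | x ∈ t C}`, i.e. Mathlib's Minkowski functional of `C`. -/
def bodyNorm (C : Set (EuclideanSpace ℝ (Fin d))) (x : EuclideanSpace ℝ (Fin d)) : ℝ :=
  gauge C x

/-- The dual norm `‖z‖_C^* = sup_{y ∈ C} |z . y|`. -/
def dualNorm (C : Set (EuclideanSpace ℝ (Fin d))) (z : EuclideanSpace ℝ (Fin d)) : ℝ :=
  sSup ((fun y => |⟪z, y⟫|) '' C)

/-- `z` is a support of the point `x` with respect to `C`. -/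
def IsSupport (C : Set (EuclideanSpace ℝ (Fin d))) (x z : EuclideanSpace ℝ (Fin d)) : Prop :=
  ⟪z, x⟫ = bodyNorm C x ^ 2 ∧ dualNorm C z = bodyNorm C x

open Classical in
/-- The duality map `φ_C`: it sends a point with a unique support to that support (and, by
convention, every other point to `0`; there are no other points when `C` is smooth). -/
def dualityMap (C : Set (EuclideanSpace ℝ (Fin d))) (x : EuclideanSpace ℝ (Fin d)) :
    EuclideanSpace ℝ (Fin d) :=
  if h : ∃! z, IsSupport C x z then h.choose else 0

variable {V : Type*}

/-- The homothetic copy `r_v C + p_v`. -/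
def homotheticCopy (C : Set (EuclideanSpace ℝ (Fin d))) (p : V → EuclideanSpace ℝ (Fin d))
    (r : V → ℝ) (v : V) : Set (EuclideanSpace ℝ (Fin d)) :=
  (fun x => r v • x + p v) '' C

/-- `(G, p, r)` is a `C`-packing: the radii are positive, the copies `r_v C + p_v` have pairwise
disjoint interiors, and `G` is their contact graph. -/
structure IsPacking (C : Set (EuclideanSpace ℝ (Fin d))) (G : SimpleGraph V)
    (p : V → EuclideanSpace ℝ (Fin d)) (r : V → ℝ) : Prop where
  radius_pos : ∀ v, 0 < r v
  disjoint_interior : ∀ v w, v ≠ w →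
    Disjoint (interior (homotheticCopy C p r v)) (interior (homotheticCopy C p r w))
  adj_iff : ∀ v w, G.Adj v w ↔
    v ≠ w ∧ (homotheticCopy C p r v ∩ homotheticCopy C p r w).Nonempty

/-- The squared rigidity map `p ↦ (½ ‖p_v - p_w‖_C²)_{vw ∈ E}`. The two ends of an edge are listed
in an arbitrary order, which does not matter when `C` is centrally symmetric. -/
def rigidityMap (C : Set (EuclideanSpace ℝ (Fin d))) (G : SimpleGraph V)
    (p : V → EuclideanSpace ℝ (Fin d)) (e : G.edgeSet) : ℝ :=
  1 / 2 * bodyNorm C (p (Quot.out e.1).1 - p (Quot.out e.1).2) ^ 2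

/-- The framework `(G, p)` is well-positioned: no edge has length `0` and the rigidity map is
differentiable at `p`. -/
def WellPositioned [Fintype V] [DecidableEq V] (C : Set (EuclideanSpace ℝ (Fin d)))
    (G : SimpleGraph V) [DecidableRel G.Adj] (p : V → EuclideanSpace ℝ (Fin d)) : Prop :=
  (∀ e, 0 < rigidityMap C G p e) ∧ DifferentiableAt ℝ (rigidityMap C G) p

/-- `a : E → ℝ` is an edge-length equilibrium stress of `(G, p)`. -/
def IsEdgeLengthEquilibriumStress [Fintype V] (C : Set (EuclideanSpace ℝ (Fin d)))
    (G : SimpleGraph V) [DecidableRel G.Adj] (p : V → EuclideanSpace ℝ (Fin d))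
    (a : G.edgeSet → ℝ) : Prop :=
  (∃ e, a e ≠ 0) ∧
  ∀ v : V,
    ∑ w : G.neighborSet v, a ⟨s(v, w.1), w.2⟩ • dualityMap C (p v - p w.1) = 0 ∧
    ∑ w : G.neighborSet v, a ⟨s(v, w.1), w.2⟩ * bodyNorm C (p v - p w.1) = 0

open Classical in
/-- The packing rigidity matrix `R_C(G, p, r)`: rows are indexed by the edges, the point columns by
the pairs `(v, i)` and the radii columns by the vertices `v`. If `v` is an end of the edge `e` and
`w` is the other end, the entries of row `e` are `[φ_C(p_v - p_w)]_i` in column `(v, i)` and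
`-(r_v + r_w)` in column `v`; all other entries of the row are `0`. -/
def packingRigidityMatrix (C : Set (EuclideanSpace ℝ (Fin d))) (G : SimpleGraph V)
    (p : V → EuclideanSpace ℝ (Fin d)) (r : V → ℝ) :
    Matrix G.edgeSet ((V × Fin d) ⊕ V) ℝ :=
  Matrix.of fun e col =>
    match col with
    | Sum.inl (v, i) =>
        if h : v ∈ e.1 then dualityMap C (p v - p (Sym2.Mem.other h)) i else 0
    | Sum.inr v =>
        if h : v ∈ e.1 then -(r v + r (Sym2.Mem.other h)) else 0

end SymPacking

end

open Filter
open scoped RealInnerProductSpace Topology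

namespace SymPacking

/-! ### Straight-line drawings and cross-product coordinates in a triangle -/

section

/-! Fix a vertex `v`. Normalising `φ_C(p_v - p_w)` by the length of the edge gives a functional
`Z_w` of dual norm one, and multiplying the stress by the length gives coefficients `b_w`. The two
equilibrium conditions become `∑ b_w = 0` and `∑ b_w Z_w = 0`, an affine dependence. Contacts at `v`
have distinct directions, and by strict convexity each `Z_w` is the only one of these functionals
attaining the norm in its own direction. So the `Z_w` are in convex position, in the cyclic order of
the contacts. If the signs of the nonzero `b_w` changed fewer than four times around `v`, a line
would separate positive from negative points and contradict the dependence (`exists_alternating`).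

The triangle inequality, with its equality case, shows that the segments joining centres of touching
bodies form a plane straight-line drawing. Cauchy's lemma (`exists_not_alternating`) then gives a
vertex with fewer than four sign changes, so the stress is zero
(`IsPacking.eq_zero_of_equilibrium`). A linear relation between the rows of the rigidity matrix
satisfies the same equations, because the length of an edge is `r_v + r_w`; hence full row rank.

Cauchy's lemma is proved by double counting instead of Euler's formula. In a maximal drawing, a
corner (two consecutive edges at angle less than π) spans an empty triangle whose third side is also
an edge, so corners come in threes. Fix a generic linear height. Each triangle has a corner at its
vertex of middle height, and at most two of its three corners separate different signs. Conversely,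
a vertex with four alternating signs has at least two sign-changing corners, and at least twice as
many as it has middle corners. The lowest vertex has no middle corner, so summation gives a strict
inequality against the bound from triangles.

Well-positionedness is independent of this: smoothness makes the norming functional unique,
compactness makes it continuous, and so the norm is differentiable off the origin. -/

/-- The plane cross product. -/
def cross (a b : EuclideanSpace ℝ (Fin 2)) : ℝ := a 0 * b 1 - a 1 * b 0

lemma cross_combo_left (o y z b : EuclideanSpace ℝ (Fin 2)) {s t : ℝ} (h : s + t = 1) :
    cross (s • y + t • z - o) b = s * cross (y - o) b + t * cross (z - o) b := by
  obtain rfl : t = 1 - s := by linarith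
  simp [cross]; ring

lemma cross_combo_right (o y z a : EuclideanSpace ℝ (Fin 2)) {s t : ℝ} (h : s + t = 1) :
    cross a (s • y + t • z - o) = s * cross a (y - o) + t * cross a (z - o) := by
  obtain rfl : t = 1 - s := by linarith
  simp [cross]; ring

lemma cross_self (a : EuclideanSpace ℝ (Fin 2)) : cross a a = 0 := by
  simp [cross]; ring

lemma cross_zero_left (a : EuclideanSpace ℝ (Fin 2)) : cross 0 a = 0 := by
  simp [cross]

lemma cross_zero_right (a : EuclideanSpace ℝ (Fin 2)) : cross a 0 = 0 := by
  simp [cross]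

lemma cross_swap (a b : EuclideanSpace ℝ (Fin 2)) : cross b a = - cross a b := by
  simp [cross]; ring

lemma cross_neg_neg (a b : EuclideanSpace ℝ (Fin 2)) : cross (-a) (-b) = cross a b := by
  simp [cross]

/-- The orientation of a triangle does not depend on the base point. -/
lemma cross_rotate (v a b : EuclideanSpace ℝ (Fin 2)) :
    cross (b - a) (v - a) = cross (a - v) (b - v) := by
  simp [cross]; ring

lemma eq_of_cross_eq {a b x y : EuclideanSpace ℝ (Fin 2)} (hD : cross a b ≠ 0)
    (h1 : cross x b = cross y b) (h2 : cross a x = cross a y) : x = y := by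
  simp only [cross] at *
  ext i
  have e0 : (x 0 - y 0) * (a 0 * b 1 - a 1 * b 0) = 0 := by
    linear_combination a 0 * h1 + b 0 * h2
  have e1 : (x 1 - y 1) * (a 0 * b 1 - a 1 * b 0) = 0 := by
    linear_combination a 1 * h1 + b 1 * h2
  fin_cases i
  · simpa [hD, sub_eq_zero] using e0
  · simpa [hD, sub_eq_zero] using e1

variable {W : Type*}

/-- The straight-line drawing of `F` with vertices `p` has no crossings. -/
structure IsPlaneDrawing (p : W → EuclideanSpace ℝ (Fin 2)) (F : SimpleGraph W) : Prop where
  vertex : ∀ v w x, F.Adj v w → p x ∉ openSegment ℝ (p v) (p w)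
  edge : ∀ v w x y, F.Adj v w → F.Adj x y → s(v, w) ≠ s(x, y) →
    Disjoint (openSegment ℝ (p v) (p w)) (openSegment ℝ (p x) (p y))

/-- The edges `va` and `vb` are consecutive around `v`, and `b` is to the left of `va`. -/
def IsCorner (p : W → EuclideanSpace ℝ (Fin 2)) (F : SimpleGraph W) (v a b : W) : Prop :=
  F.Adj v a ∧ F.Adj v b ∧ 0 < cross (p a - p v) (p b - p v) ∧
    ∀ c, F.Adj v c → ¬ (0 < cross (p a - p v) (p c - p v) ∧ 0 < cross (p c - p v) (p b - p v))

lemma openSegment_congr_sym2 {p : W → EuclideanSpace ℝ (Fin 2)} {v w x y : W}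
    (h : s(v, w) = s(x, y)) : openSegment ℝ (p v) (p w) = openSegment ℝ (p x) (p y) := by
  rcases Sym2.eq_iff.1 h with ⟨rfl, rfl⟩ | ⟨rfl, rfl⟩
  · rfl
  · exact openSegment_symm _ _ _

lemma IsPlaneDrawing.sym2_eq {p : W → EuclideanSpace ℝ (Fin 2)} {F : SimpleGraph W}
    (hF : IsPlaneDrawing p F) {v b y z : W} (hvb : F.Adj v b) (hyz : F.Adj y z)
    {m : EuclideanSpace ℝ (Fin 2)} (hm : m ∈ openSegment ℝ (p y) (p z))
    (hm' : m ∈ segment ℝ (p v) (p b)) : s(y, z) = s(v, b) := by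
  by_contra hne
  rw [← insert_endpoints_openSegment] at hm'
  rcases hm' with rfl | rfl | h
  · exact hF.vertex _ _ _ hyz hm
  · exact hF.vertex _ _ _ hyz hm
  · exact Set.disjoint_left.1 (hF.edge _ _ _ _ hyz hvb hne) hm h

/-- A point on the side `va` of the angle `avb`, given by its cross products, lies on `[v, a]`. -/
lemma mem_segment_of_cross {v a b m : EuclideanSpace ℝ (Fin 2)} (hD : 0 < cross (a - v) (b - v))
    (h0 : cross (a - v) (m - v) = 0) (h1 : 0 ≤ cross (m - v) (b - v))
    (h2 : cross (m - v) (b - v) ≤ cross (a - v) (b - v)) : m ∈ segment ℝ v a := by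
  set D := cross (a - v) (b - v)
  set t := cross (m - v) (b - v) / D with ht
  have ht0 : 0 ≤ t := by positivity
  have ht1 : t ≤ 1 := (div_le_one hD).2 h2
  refine ⟨1 - t, t, by linarith, ht0, by ring, ?_⟩
  have hs : (1 - t) + t = 1 := by ring
  have := eq_of_cross_eq (x := (1 - t) • v + t • a - v) (y := m - v) hD.ne' ?_ ?_
  · simpa using this
  · rw [cross_combo_left _ _ _ _ hs, sub_self, cross_zero_left]
    rw [ht]; field_simp; simp [D]
  · rw [cross_combo_right _ _ _ _ hs, sub_self, cross_zero_right, cross_self, h0]; ring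

lemma mem_segment_of_cross' {v a b m : EuclideanSpace ℝ (Fin 2)} (hD : 0 < cross (a - v) (b - v))
    (h0 : cross (m - v) (b - v) = 0) (h1 : 0 ≤ cross (a - v) (m - v))
    (h2 : cross (a - v) (m - v) ≤ cross (a - v) (b - v)) : m ∈ segment ℝ v b := by
  set D := cross (a - v) (b - v)
  set t := cross (a - v) (m - v) / D with ht
  have ht0 : 0 ≤ t := by positivity
  have ht1 : t ≤ 1 := (div_le_one hD).2 h2
  refine ⟨1 - t, t, by linarith, ht0, by ring, ?_⟩
  have hs : (1 - t) + t = 1 := by ring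
  have := eq_of_cross_eq (x := (1 - t) • v + t • b - v) (y := m - v) hD.ne' ?_ ?_
  · simpa using this
  · rw [cross_combo_left _ _ _ _ hs, sub_self, cross_zero_left, cross_self, h0]; ring
  · rw [cross_combo_right _ _ _ _ hs, sub_self, cross_zero_right]
    rw [ht]; field_simp; simp [D]

lemma exists_mem_openSegment_between {y z q : EuclideanSpace ℝ (Fin 2)}
    (hq : q ∈ openSegment ℝ y z) {l : ℝ} (h0 : 0 < l) (h1 : l < 1) :
    (1 - l) • q + l • y ∈ openSegment ℝ y z := by
  obtain ⟨s, t, hs, ht, hst, rfl⟩ := hq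
  refine ⟨(1 - l) * s + l, (1 - l) * t, ?_, ?_, ?_, ?_⟩
  · nlinarith
  · nlinarith
  · linear_combination (1 - l) * hst
  · module

/-- An edge that passes through the open angle at a corner cannot leave the triangle through
one of the two sides at the corner. -/
lemma IsPlaneDrawing.no_escape {p : W → EuclideanSpace ℝ (Fin 2)} {F : SimpleGraph W}
    (hF : IsPlaneDrawing p F) {v a b y z : W} (ha : F.Adj v a) (hb : F.Adj v b)
    (hD : 0 < cross (p a - p v) (p b - p v)) (hyz : F.Adj y z)
    {q : EuclideanSpace ℝ (Fin 2)} (hq : q ∈ openSegment ℝ (p y) (p z))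
    (hA : 0 < cross (q - p v) (p b - p v)) (hB : 0 < cross (p a - p v) (q - p v))
    (hq1 : cross (q - p v) (p b - p v) + cross (p a - p v) (q - p v)
      ≤ cross (p a - p v) (p b - p v))
    (hyq : cross (p y - p v) (p b - p v) + cross (p a - p v) (p y - p v)
      ≤ cross (q - p v) (p b - p v) + cross (p a - p v) (q - p v)) :
    0 ≤ cross (p y - p v) (p b - p v) ∧ 0 ≤ cross (p a - p v) (p y - p v) := by
  -- Up to the factor `D = cross (p a - p v) (p b - p v)`, `A` and `B` are the coordinates of `x - p
  -- v` in the basis `p a - p v`, `p b - p v`. The triangle is `A, B ≥ 0`, `A + B ≤ D`, and `A + B`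
  -- measures the level above `v`, parallel to the side `ab`.
  set A := fun x : EuclideanSpace ℝ (Fin 2) => cross (x - p v) (p b - p v) with hAdef
  set B := fun x : EuclideanSpace ℝ (Fin 2) => cross (p a - p v) (x - p v) with hBdef
  have hAl : ∀ l : ℝ, A ((1 - l) • q + l • p y) = (1 - l) * A q + l * A (p y) :=
    fun l => cross_combo_left _ _ _ _ (by ring)
  have hBl : ∀ l : ℝ, B ((1 - l) • q + l • p y) = (1 - l) * B q + l * B (p y) :=
    fun l => cross_combo_right _ _ _ _ (by ring)
  change 0 < A q at hA
  change 0 < B q at hB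
  change A q + B q ≤ _ at hq1
  change A (p y) + B (p y) ≤ A q + B q at hyq
  change 0 ≤ A (p y) ∧ 0 ≤ B (p y)
  -- On the way from `q` to `y` the edge cannot meet a side of the angle inside the triangle:
  -- planarity would make it equal to that side, but `q` is off both sides.
  have key : ∀ l : ℝ, 0 < l → l < 1 →
      ((1 - l) * A q + l * A (p y) = 0 → 0 ≤ (1 - l) * B q + l * B (p y) → False) ∧
      ((1 - l) * B q + l * B (p y) = 0 → 0 ≤ (1 - l) * A q + l * A (p y) → False) := by
    intro l h0 h1
    have hm := exists_mem_openSegment_between hq h0 h1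
    have hle : ((1 - l) * A q + l * A (p y)) + ((1 - l) * B q + l * B (p y)) ≤ A q + B q := by
      nlinarith
    constructor
    · intro e1 e2
      have := hF.sym2_eq hb hyz hm
        (mem_segment_of_cross' hD ((hAl l).trans e1) ((hBl l).ge.trans' e2)
          ((hBl l).le.trans (by linarith)))
      rw [openSegment_congr_sym2 this] at hq
      obtain ⟨s, t, hs, ht, hst, rfl⟩ := hq
      have : A (s • p v + t • p b) = 0 := by
        simp only [hAdef]
        rw [cross_combo_left _ _ _ _ hst, sub_self, cross_zero_left, cross_self]; ring
      linarith
    · intro e1 e2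
      have := hF.sym2_eq ha hyz hm
        (mem_segment_of_cross hD ((hBl l).trans e1) ((hAl l).ge.trans' e2)
          ((hAl l).le.trans (by linarith)))
      rw [openSegment_congr_sym2 this] at hq
      obtain ⟨s, t, hs, ht, hst, rfl⟩ := hq
      have : B (s • p v + t • p a) = 0 := by
        simp only [hBdef]
        rw [cross_combo_right _ _ _ _ hst, sub_self, cross_zero_right, cross_self]; ring
      linarith
  by_contra hcon
  have root : ∀ {P Q : ℝ}, 0 < P → Q < 0 → 0 < P / (P - Q) ∧ P / (P - Q) < 1 ∧
      (1 - P / (P - Q)) * P + P / (P - Q) * Q = 0 := by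
    intro P Q hP hQ
    have : 0 < P - Q := by linarith
    refine ⟨by positivity, (div_lt_one this).2 (by linarith), by field_simp; ring⟩
  -- If one coordinate is already negative where the other vanishes, its own zero comes earlier, and
  -- there the other is still nonnegative. So the first exit point lies on a side.
  have cmp : ∀ {P Q R S l : ℝ}, 0 < P → Q < 0 → 0 < R → l < 1 → 0 < l →
      (1 - l) * R + l * S = 0 → (1 - l) * P + l * Q < 0 →
      0 ≤ (1 - P / (P - Q)) * R + P / (P - Q) * S := by
    intro P Q R S l hP hQ hR hl1 hl0 e1 e2
    have hPQ : 0 < P - Q := by linarith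
    have hlt : P / (P - Q) < l := by rw [div_lt_iff₀ hPQ]; nlinarith
    set k := P / (P - Q)
    have : l * ((1 - k) * R + k * S) = (l - k) * R := by linear_combination k * e1
    have : 0 ≤ l * ((1 - k) * R + k * S) := by
      rw [this]; exact mul_nonneg (by linarith) hR.le
    exact nonneg_of_mul_nonneg_right this hl0
  by_cases hAy : A (p y) < 0
  · obtain ⟨h0, h1, h2⟩ := root hA hAy
    by_cases hBm : 0 ≤ (1 - A q / (A q - A (p y))) * B q + A q / (A q - A (p y)) * B (p y)
    · exact (key _ h0 h1).1 h2 hBm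
    · push Not at hBm
      have hBy : B (p y) < 0 := by
        by_contra h
        push Not at h
        have := mul_nonneg h0.le h
        have := mul_pos (sub_pos.2 h1) hB
        linarith
      obtain ⟨h0', h1', h2'⟩ := root hB hBy
      exact (key _ h0' h1').2 h2' (cmp hB hBy hA h1 h0 h2 hBm)
  · have hBy : B (p y) < 0 := by
      by_contra h
      exact hcon ⟨not_lt.1 hAy, not_lt.1 h⟩
    obtain ⟨h0, h1, h2⟩ := root hB hBy
    refine (key _ h0 h1).2 h2 ?_
    have := mul_nonneg h0.le (not_lt.1 hAy)
    have := mul_pos (sub_pos.2 h1) hA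
    linarith

end

/-! ### Maximal drawings: corners are corners of empty triangles -/

section

variable {W : Type*}

lemma adj_of_maximal {p : W → EuclideanSpace ℝ (Fin 2)} {F : SimpleGraph W}
    (hF : Maximal (IsPlaneDrawing p) F) {v w : W} (hvw : v ≠ w)
    (h1 : ∀ x, p x ∉ openSegment ℝ (p v) (p w))
    (h2 : ∀ x y, F.Adj x y → s(x, y) ≠ s(v, w) →
      Disjoint (openSegment ℝ (p v) (p w)) (openSegment ℝ (p x) (p y))) : F.Adj v w := by
  have hadj : ∀ x y, (F ⊔ SimpleGraph.edge v w).Adj x y → F.Adj x y ∨ s(x, y) = s(v, w) := by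
    intro x y h
    rw [SimpleGraph.sup_adj, SimpleGraph.edge_adj] at h
    rcases h with h | ⟨h, -⟩
    · exact Or.inl h
    · right
      rw [Sym2.eq_iff]; tauto
  have hD : IsPlaneDrawing p (F ⊔ SimpleGraph.edge v w) := by
    constructor
    · intro x y z hxy
      rcases hadj _ _ hxy with h | h
      · exact hF.prop.vertex _ _ _ h
      · rw [openSegment_congr_sym2 h]; exact h1 z
    · intro x y x' y' hxy hxy' hne
      rcases hadj _ _ hxy with h | h <;> rcases hadj _ _ hxy' with h' | h'
      · exact hF.prop.edge _ _ _ _ h h' hne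
      · rw [openSegment_congr_sym2 h']
        exact (h2 _ _ h (h' ▸ hne)).symm
      · rw [openSegment_congr_sym2 h]
        exact h2 _ _ h' (h ▸ hne.symm)
      · exact absurd (h.trans h'.symm) hne
  refine hF.le_of_ge hD le_sup_left ?_
  rw [SimpleGraph.sup_adj, SimpleGraph.edge_adj]
  exact Or.inr ⟨Or.inl ⟨rfl, rfl⟩, hvw⟩

/-- No edge at `v` passes through the open angle of a corner at `v`. -/
lemma IsCorner.not_adj_through {p : W → EuclideanSpace ℝ (Fin 2)} {F : SimpleGraph W}
    {v a b z : W} (h : IsCorner p F v a b) (hz : F.Adj v z)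
    {q : EuclideanSpace ℝ (Fin 2)} (hq : q ∈ openSegment ℝ (p v) (p z))
    (hA : 0 < cross (q - p v) (p b - p v)) (hB : 0 < cross (p a - p v) (q - p v)) : False := by
  obtain ⟨s, t, hs, ht, hst, rfl⟩ := hq
  rw [cross_combo_left _ _ _ _ hst, sub_self, cross_zero_left, mul_zero, zero_add] at hA
  rw [cross_combo_right _ _ _ _ hst, sub_self, cross_zero_right, mul_zero, zero_add] at hB
  exact h.2.2.2 z hz ⟨pos_of_mul_pos_right hB ht.le, pos_of_mul_pos_right hA ht.le⟩

/-- If an edge passes through the triangle at a corner and descends towards the corner, then it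
ends in the triangle. -/
lemma IsCorner.exists_end {p : W → EuclideanSpace ℝ (Fin 2)} {F : SimpleGraph W}
    (hF : IsPlaneDrawing p F) {v a b : W} (h : IsCorner p F v a b) {y z : W} (hyz : F.Adj y z)
    {q : EuclideanSpace ℝ (Fin 2)} (hq : q ∈ openSegment ℝ (p y) (p z))
    (hA : 0 < cross (q - p v) (p b - p v)) (hB : 0 < cross (p a - p v) (q - p v))
    (hq1 : cross (q - p v) (p b - p v) + cross (p a - p v) (q - p v)
      ≤ cross (p a - p v) (p b - p v))
    (hyq : cross (p y - p v) (p b - p v) + cross (p a - p v) (p y - p v)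
      ≤ cross (q - p v) (p b - p v) + cross (p a - p v) (q - p v)) :
    y ≠ v ∧ 0 ≤ cross (p y - p v) (p b - p v) ∧ 0 ≤ cross (p a - p v) (p y - p v) := by
  refine ⟨?_, hF.no_escape h.1 h.2.1 h.2.2.1 hyz hq hA hB hq1 hyq⟩
  rintro rfl
  exact h.not_adj_through hyz hq hA hB

/-- Among the offending vertices take one at the lowest level. An obstruction to joining it to `v`
would leave a vertex in the triangle at a strictly lower level, so maximality supplies that edge,
which runs inside the angle of the corner. -/
lemma IsCorner.triangle_empty [Finite W] {p : W → EuclideanSpace ℝ (Fin 2)} {F : SimpleGraph W}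
    (hp : Function.Injective p) (hF : Maximal (IsPlaneDrawing p) F) {v a b : W}
    (h : IsCorner p F v a b) {x : W} (hxv : x ≠ v) (hxa : x ≠ a) (hxb : x ≠ b)
    (hA : 0 ≤ cross (p x - p v) (p b - p v)) (hB : 0 ≤ cross (p a - p v) (p x - p v))
    (hAB : cross (p x - p v) (p b - p v) + cross (p a - p v) (p x - p v)
      ≤ cross (p a - p v) (p b - p v)) : False := by
  have hD := h.2.2.1
  set A := fun x : EuclideanSpace ℝ (Fin 2) => cross (x - p v) (p b - p v) with hAdef
  set B := fun x : EuclideanSpace ℝ (Fin 2) => cross (p a - p v) (x - p v) with hBdef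
  let S : Set W := {x | x ≠ v ∧ x ≠ a ∧ x ≠ b ∧ 0 ≤ A (p x) ∧ 0 ≤ B (p x) ∧
    A (p x) + B (p x) ≤ cross (p a - p v) (p b - p v)}
  obtain ⟨x, ⟨hxv, hxa, hxb, hA, hB, hAB⟩, hmin⟩ :=
    S.toFinite.exists_minimalFor (fun x => A (p x) + B (p x)) S ⟨x, hxv, hxa, hxb, hA, hB, hAB⟩
  have hmin' : ∀ y ∈ S, A (p x) + B (p x) ≤ A (p y) + B (p y) := by
    intro y hy
    by_contra hlt
    exact hlt (hmin hy (le_of_not_ge hlt))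
  have hnot : ∀ y ∈ S, ¬ A (p y) + B (p y) < A (p x) + B (p x) := fun y hy => not_lt.2 (hmin' y hy)
  have hseg : ∀ {c}, F.Adj v c → x ≠ c → p x ∉ segment ℝ (p v) (p c) := by
    intro c hc hxc hm
    rw [← insert_endpoints_openSegment] at hm
    rcases hm with e | e | e
    · exact hxv (hp e)
    · exact hxc (hp e)
    · exact hF.prop.vertex _ _ _ hc e
  have hA' : 0 < A (p x) := by
    refine lt_of_le_of_ne hA fun e => hseg h.2.1 hxb ?_
    exact mem_segment_of_cross' hD e.symm hB (by simp only [hAdef, hBdef] at *; linarith)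
  have hB' : 0 < B (p x) := by
    refine lt_of_le_of_ne hB fun e => hseg h.1 hxa ?_
    exact mem_segment_of_cross hD e.symm hA (by simp only [hAdef, hBdef] at *; linarith)
  have hav : ∀ {s t : ℝ}, s + t = 1 → A (s • p v + t • p x) = t * A (p x) ∧
      B (s • p v + t • p x) = t * B (p x) := by
    intro s t hst
    constructor
    · simp only [hAdef]
      rw [cross_combo_left _ _ _ _ hst, sub_self, cross_zero_left, mul_zero, zero_add]
    · simp only [hBdef]
      rw [cross_combo_right _ _ _ _ hst, sub_self, cross_zero_right, mul_zero, zero_add]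
  have hAa : A (p a) = cross (p a - p v) (p b - p v) := rfl
  have hBb : B (p b) = cross (p a - p v) (p b - p v) := rfl
  have hBa : B (p a) = 0 := cross_self _
  have hAb : A (p b) = 0 := cross_self _
  have hAv : A (p v) = 0 := by simp only [hAdef, sub_self, cross_zero_left]
  have hBv : B (p v) = 0 := by simp only [hBdef, sub_self, cross_zero_right]
  have hadj : F.Adj v x := by
    refine adj_of_maximal hF hxv.symm ?_ ?_
    · rintro y ⟨s, t, hs, ht, hst, hy⟩
      obtain ⟨e1, e2⟩ := hav hst
      rw [hy] at e1 e2
      have p1 := mul_pos ht hA'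
      have p2 := mul_pos ht hB'
      have p3 := mul_pos hs hA'
      have p4 := mul_pos hs hB'
      have hlt : A (p y) + B (p y) < A (p x) + B (p x) := by
        rw [e1, e2]; obtain rfl : s = 1 - t := by linarith
        linarith
      refine hnot y ⟨?_, ?_, ?_, by linarith, by linarith, by linarith⟩ hlt
      · rintro rfl; linarith
      · rintro rfl; linarith
      · rintro rfl; linarith
    · intro y z hyz hne
      rw [Set.disjoint_left]
      rintro q ⟨s, t, hs, ht, hst, hq⟩ hq'
      obtain ⟨e1, e2⟩ := hav hst
      rw [hq] at e1 e2
      have p1 := mul_pos ht hA'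
      have p2 := mul_pos ht hB'
      have p3 := mul_pos hs hA'
      have p4 := mul_pos hs hB'
      have hlt : A q + B q < A (p x) + B (p x) := by
        rw [e1, e2]; obtain rfl : s = 1 - t := by linarith
        linarith
      have main : ∀ y z, F.Adj y z → q ∈ openSegment ℝ (p y) (p z) →
          A (p y) + B (p y) ≤ A q + B q → False := by
        intro y z hyz hq' hle
        obtain ⟨g1, g2, g3⟩ := h.exists_end hF.prop hyz hq' (by linarith : 0 < A q)
          (by linarith : 0 < B q) (by linarith : A q + B q ≤ _) hle
        refine hnot y ⟨g1, ?_, ?_, g2, g3, by linarith⟩ (by linarith)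
        · rintro rfl; linarith
        · rintro rfl; linarith
      by_cases hle : A (p y) + B (p y) ≤ A q + B q
      · exact main y z hyz hq' hle
      · refine main z y hyz.symm (openSegment_symm ℝ (p y) (p z) ▸ hq') ?_
        obtain ⟨s', t', hs', ht', hst', rfl⟩ := hq'
        have f1 : A (s' • p y + t' • p z) = s' * A (p y) + t' * A (p z) :=
          cross_combo_left _ _ _ _ hst'
        have f2 : B (s' • p y + t' • p z) = s' * B (p y) + t' * B (p z) :=
          cross_combo_right _ _ _ _ hst'
        rw [f1, f2] at hle ⊢
        obtain rfl : t' = 1 - s' := by linarith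
        push Not at hle
        have := pos_of_mul_pos_right (a := 1 - s')
          (b := (A (p y) + B (p y)) - (A (p z) + B (p z))) (by linarith) ht'.le
        have := mul_pos hs' this
        linarith
  exact h.2.2.2 x hadj ⟨hB', hA'⟩

/-- An edge crossing the side `ab` has a lower end in the triangle, which must be `a` or `b` by
emptiness. That end already has the level of `ab`, which forces the other end to that level too, so
the edge is `ab` itself. Maximality then adds the side. -/
lemma IsCorner.adj [Finite W] {p : W → EuclideanSpace ℝ (Fin 2)} {F : SimpleGraph W}
    (hp : Function.Injective p) (hF : Maximal (IsPlaneDrawing p) F) {v a b : W}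
    (h : IsCorner p F v a b) : F.Adj a b := by
  have hD := h.2.2.1
  set D := cross (p a - p v) (p b - p v) with hDdef
  set A := fun x : EuclideanSpace ℝ (Fin 2) => cross (x - p v) (p b - p v) with hAdef
  set B := fun x : EuclideanSpace ℝ (Fin 2) => cross (p a - p v) (x - p v) with hBdef
  have hAa : A (p a) = D := rfl
  have hBb : B (p b) = D := rfl
  have hBa : B (p a) = 0 := cross_self _
  have hAb : A (p b) = 0 := cross_self _
  have hAv : A (p v) = 0 := by simp only [hAdef, sub_self, cross_zero_left]
  have hBv : B (p v) = 0 := by simp only [hBdef, sub_self, cross_zero_right]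
  have hab : ∀ {s t : ℝ}, s + t = 1 → A (s • p a + t • p b) = s * D ∧
      B (s • p a + t • p b) = t * D := by
    intro s t hst
    constructor
    · have : A (s • p a + t • p b) = s * A (p a) + t * A (p b) := cross_combo_left _ _ _ _ hst
      rw [this, hAa, hAb]; ring
    · have : B (s • p a + t • p b) = s * B (p a) + t * B (p b) := cross_combo_right _ _ _ _ hst
      rw [this, hBa, hBb]; ring
  have hne : a ≠ b := by rintro rfl; rw [hDdef, cross_self] at hD; exact hD.ne rfl
  refine adj_of_maximal hF hne ?_ ?_
  · rintro x ⟨s, t, hs, ht, hst, hx⟩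
    obtain ⟨e1, e2⟩ := hab hst
    rw [hx] at e1 e2
    have p1 := mul_pos hs hD
    have p2 := mul_pos ht hD
    refine h.triangle_empty hp hF (x := x) ?_ ?_ ?_ (by linarith : 0 ≤ A (p x))
      (by linarith : 0 ≤ B (p x)) ?_
    · rintro rfl; linarith
    · rintro rfl; linarith
    · rintro rfl; linarith
    · change A (p x) + B (p x) ≤ D
      rw [e1, e2]; obtain rfl : s = 1 - t := by linarith
      linarith
  · intro y z hyz hne'
    rw [Set.disjoint_left]
    rintro q ⟨s, t, hs, ht, hst, hq⟩ hq'
    obtain ⟨e1, e2⟩ := hab hst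
    rw [hq] at e1 e2
    have p1 := mul_pos hs hD
    have p2 := mul_pos ht hD
    have hsum : A q + B q = D := by
      rw [e1, e2]; obtain rfl : s = 1 - t := by linarith
      ring
    have main : ∀ y z, F.Adj y z → q ∈ openSegment ℝ (p y) (p z) →
        A (p y) + B (p y) ≤ D → y ≠ v ∧ (y = a ∨ y = b) := by
      intro y z hyz hq' hle
      obtain ⟨g1, g2, g3⟩ := h.exists_end hF.prop hyz hq' (by linarith : 0 < A q)
        (by linarith : 0 < B q) (by linarith : A q + B q ≤ D)
        (by linarith : A (p y) + B (p y) ≤ A q + B q)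
      refine ⟨g1, ?_⟩
      by_contra hcon
      push Not at hcon
      exact h.triangle_empty hp hF g1 hcon.1 hcon.2 g2 g3 hle
    have other : ∀ y z, F.Adj y z → s(y, z) ≠ s(a, b) → q ∈ openSegment ℝ (p y) (p z) →
        A (p y) + B (p y) ≤ D → False := by
      intro y z hyz hne' hq' hle
      have hy := main y z hyz hq' hle
      have hyD : A (p y) + B (p y) = D := by
        rcases hy.2 with rfl | rfl
        · rw [hAa, hBa]; ring
        · rw [hAb, hBb]; ring
      have hz : A (p z) + B (p z) ≤ D := by
        obtain ⟨s', t', hs', ht', hst', rfl⟩ := hq'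
        have f1 : A (s' • p y + t' • p z) = s' * A (p y) + t' * A (p z) :=
          cross_combo_left _ _ _ _ hst'
        have f2 : B (s' • p y + t' • p z) = s' * B (p y) + t' * B (p z) :=
          cross_combo_right _ _ _ _ hst'
        rw [f1, f2] at hsum
        obtain rfl : s' = 1 - t' := by linarith
        have : t' * (A (p z) + B (p z) - D) = 0 := by linear_combination hsum - (1 - t') * hyD
        rcases mul_eq_zero.1 this with h0 | h0 <;> linarith
      have hz' := main z y hyz.symm (openSegment_symm ℝ (p y) (p z) ▸ hq') hz
      rcases hy.2 with rfl | rfl <;> rcases hz'.2 with rfl | rfl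
      · exact hyz.ne rfl
      · exact hne' rfl
      · exact hne' Sym2.eq_swap
      · exact hyz.ne rfl
    by_cases hle : A (p y) + B (p y) ≤ D
    · exact other y z hyz hne' hq' hle
    · refine other z y hyz.symm (by rwa [Sym2.eq_swap]) (openSegment_symm ℝ (p y) (p z) ▸ hq') ?_
      obtain ⟨s', t', hs', ht', hst', rfl⟩ := hq'
      have f1 : A (s' • p y + t' • p z) = s' * A (p y) + t' * A (p z) :=
        cross_combo_left _ _ _ _ hst'
      have f2 : B (s' • p y + t' • p z) = s' * B (p y) + t' * B (p z) :=
        cross_combo_right _ _ _ _ hst'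
      rw [f1, f2] at hsum
      push Not at hle
      obtain rfl : s' = 1 - t' := by linarith
      by_contra hcon
      push Not at hcon
      have := mul_pos hs (sub_pos.2 hle)
      have g1 := mul_pos hs' (sub_pos.2 hle)
      have g2 := mul_pos ht' (sub_pos.2 hcon)
      linarith

/-- The corners of a maximal drawing are the corners of triangles. -/
lemma IsCorner.rotate [Finite W] {p : W → EuclideanSpace ℝ (Fin 2)} {F : SimpleGraph W}
    (hp : Function.Injective p) (hF : Maximal (IsPlaneDrawing p) F) {v a b : W}
    (h : IsCorner p F v a b) : IsCorner p F a b v := by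
  have hD := h.2.2.1
  refine ⟨h.adj hp hF, h.1.symm, by rwa [cross_rotate], ?_⟩
  rintro c hc ⟨h1, h2⟩
  have e1 : cross (p b - p a) (p c - p a) = cross (p a - p v) (p b - p v)
      - cross (p c - p v) (p b - p v) - cross (p a - p v) (p c - p v) := by
    simp [cross]; ring
  have e2 : cross (p c - p a) (p v - p a) = cross (p a - p v) (p c - p v) := by
    simp [cross]; ring
  rw [e1] at h1
  rw [e2] at h2
  have hcv : c ≠ v := by
    rintro rfl; simp [cross_zero_right] at h2
  have hcb : c ≠ b := by
    rintro rfl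
    rw [cross_self] at h1; linarith
  -- An edge `ac` inside the angle at `a` either ends in the triangle, which is empty, or leaves it
  -- through `vb`. The weights below locate the crossing with `vb`, where the coordinate `A`
  -- vanishes.
  by_cases hA : 0 ≤ cross (p c - p v) (p b - p v)
  · exact h.triangle_empty hp hF hcv hc.ne' hcb hA h2.le (by linarith)
  push Not at hA
  set D := cross (p a - p v) (p b - p v) with hDdef
  set Ac := cross (p c - p v) (p b - p v) with hAc
  set Bc := cross (p a - p v) (p c - p v) with hBc
  have hk : 0 < D - Ac := by linarith
  have hst : -Ac / (D - Ac) + D / (D - Ac) = 1 := by field_simp; ring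
  have hs : 0 < -Ac / (D - Ac) := div_pos (by linarith) hk
  have ht : 0 < D / (D - Ac) := div_pos hD hk
  have hm : (-Ac / (D - Ac)) • p a + (D / (D - Ac)) • p c ∈ openSegment ℝ (p a) (p c) :=
    ⟨_, _, hs, ht, hst, rfl⟩
  have hseg : (-Ac / (D - Ac)) • p a + (D / (D - Ac)) • p c ∈ segment ℝ (p v) (p b) := by
    have f2 : cross (p a - p v) ((-Ac / (D - Ac)) • p a + (D / (D - Ac)) • p c - p v)
        = D / (D - Ac) * Bc := by
      rw [cross_combo_right _ _ _ _ hst, cross_self]; ring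
    refine mem_segment_of_cross' (a := p a) hD ?_ ?_ ?_
    · rw [cross_combo_left _ _ _ _ hst, ← hDdef, ← hAc]; field_simp; ring
    · rw [f2]; positivity
    · rw [f2, div_mul_eq_mul_div, div_le_iff₀ hk]
      exact mul_le_mul_of_nonneg_left (by linarith) hD.le
  have := hF.prop.sym2_eq h.2.1 hc hm hseg
  rcases Sym2.eq_iff.1 this with ⟨e, -⟩ | ⟨e, -⟩
  · exact h.1.ne e.symm
  · subst e
    rw [hDdef, cross_self] at hD; exact hD.ne rfl

end

/-! ### Label changes along a linear order -/

section

section Changes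

variable {ι κ : Type*} [LinearOrder κ]

/-- Between two elements with different labels there are two consecutive ones with different
labels. -/
lemma exists_consecutive_change (k : ι → κ) (S : Finset ι) (hk : Set.InjOn k S) (s : ι → Prop)
    {a b : ι} (ha : a ∈ S) (hb : b ∈ S) (hab : k a < k b) (hs : ¬ (s a ↔ s b)) :
    ∃ c ∈ S, ∃ d ∈ S, k a ≤ k c ∧ k c < k d ∧ k d ≤ k b ∧ ¬ (s c ↔ s d) ∧
      ∀ e ∈ S, ¬ (k c < k e ∧ k e < k d) := by
  classical
  obtain ⟨d, hd, hdmin⟩ := (S.filter fun x => k a < k x ∧ ¬ (s a ↔ s x)).exists_min_image k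
    ⟨b, by simp [hb, hab, hs]⟩
  simp only [Finset.mem_filter] at hd hdmin
  obtain ⟨c, hc, hcmax⟩ := (S.filter fun x => k x < k d).exists_max_image k
    ⟨a, by simp [ha, hd.2.1]⟩
  simp only [Finset.mem_filter] at hc hcmax
  have hac : k a ≤ k c := hcmax a ⟨ha, hd.2.1⟩
  have hsc : s a ↔ s c := by
    rcases hac.lt_or_eq with h | h
    · by_contra hne
      exact absurd (hdmin c ⟨hc.1, h, hne⟩) (not_le.2 hc.2)
    · rw [hk ha hc.1 h]
  refine ⟨c, hc.1, d, hd.1, hac, hc.2, hdmin b ⟨hb, hab, hs⟩, ?_, ?_⟩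
  · rw [← hsc]; exact hd.2.2
  · rintro e he ⟨h1, h2⟩
    exact absurd (hcmax e ⟨he, h2⟩) (not_le.2 h1)

open Classical in
/-- The consecutive pairs of `S`, in the order given by `k`, whose labels differ. -/
noncomputable def changes (k : ι → κ) (S : Finset ι) (s : ι → Prop) : Finset (ι × ι) :=
  (S ×ˢ S).filter fun c => k c.1 < k c.2 ∧ ¬ (s c.1 ↔ s c.2) ∧
    ∀ e ∈ S, ¬ (k c.1 < k e ∧ k e < k c.2)

/-- Four elements in increasing order with alternating labels. -/
def Alternating (k : ι → κ) (S : Finset ι) (s : ι → Prop) (w : Fin 4 → ι) : Prop :=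
  (∀ i, w i ∈ S) ∧ k (w 0) < k (w 1) ∧ k (w 1) < k (w 2) ∧ k (w 2) < k (w 3) ∧
    ¬ (s (w 0) ↔ s (w 1)) ∧ ¬ (s (w 1) ↔ s (w 2)) ∧ ¬ (s (w 2) ↔ s (w 3))

lemma exists_mem_changes (k : ι → κ) (S : Finset ι) (hk : Set.InjOn k S) (s : ι → Prop)
    {a b : ι} (ha : a ∈ S) (hb : b ∈ S) (hab : k a < k b) (hs : ¬ (s a ↔ s b)) :
    ∃ c ∈ changes k S s, k a ≤ k c.1 ∧ k c.1 < k c.2 ∧ k c.2 ≤ k b := by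
  obtain ⟨c, hc, d, hd, h1, h2, h3, h4, h5⟩ := exists_consecutive_change k S hk s ha hb hab hs
  refine ⟨(c, d), ?_, h1, h2, h3⟩
  simp only [changes, Finset.mem_filter, Finset.mem_product]
  exact ⟨⟨hc, hd⟩, h2, h4, h5⟩

lemma Alternating.exists_three {k : ι → κ} {S : Finset ι} (hk : Set.InjOn k S) {s : ι → Prop}
    {w : Fin 4 → ι} (h : Alternating k S s w) : ∃ c₁ ∈ changes k S s, ∃ c₂ ∈ changes k S s,
      ∃ c₃ ∈ changes k S s, k (w 0) ≤ k c₁.1 ∧ k c₁.1 < k c₂.1 ∧ k c₂.1 < k c₃.1 ∧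
        k c₃.2 ≤ k (w 3) ∧ k c₃.1 < k c₃.2 := by
  obtain ⟨hS, h01, h12, h23, s01, s12, s23⟩ := h
  obtain ⟨c₁, m₁, a₁, b₁, d₁⟩ := exists_mem_changes k S hk s (hS 0) (hS 1) h01 s01
  obtain ⟨c₂, m₂, a₂, b₂, d₂⟩ := exists_mem_changes k S hk s (hS 1) (hS 2) h12 s12
  obtain ⟨c₃, m₃, a₃, b₃, d₃⟩ := exists_mem_changes k S hk s (hS 2) (hS 3) h23 s23
  exact ⟨c₁, m₁, c₂, m₂, c₃, m₃, a₁, b₁.trans_le (d₁.trans a₂), b₂.trans_le (d₂.trans a₃), d₃, b₃⟩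

lemma Alternating.three_le {k : ι → κ} {S : Finset ι} (hk : Set.InjOn k S) {s : ι → Prop}
    {w : Fin 4 → ι} (h : Alternating k S s w) : 3 ≤ (changes k S s).card := by
  classical
  obtain ⟨c₁, m₁, c₂, m₂, c₃, m₃, -, h12, h23, -, -⟩ := h.exists_three hk
  have : ({c₁, c₂, c₃} : Finset (ι × ι)) ⊆ changes k S s := by
    intro x; simp only [Finset.mem_insert, Finset.mem_singleton]
    rintro (rfl | rfl | rfl) <;> assumption
  refine le_trans (le_of_eq ?_) (Finset.card_le_card this)
  rw [Finset.card_eq_three.2 ⟨c₁, c₂, c₃, ?_, ?_, ?_, rfl⟩]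
  · rintro rfl; exact h12.ne rfl
  · rintro rfl; exact (h12.trans h23).ne rfl
  · rintro rfl; exact h23.ne rfl

/-- If the first and the last label agree, then the number of changes exceeds three. -/
lemma Alternating.four_le {k : ι → κ} {S : Finset ι} (hk : Set.InjOn k S) {s : ι → Prop}
    {w : Fin 4 → ι} (h : Alternating k S s w) {a b : ι} (ha : a ∈ S) (hb : b ∈ S)
    (hmin : ∀ e ∈ S, k a ≤ k e) (hmax : ∀ e ∈ S, k e ≤ k b) (hab : s a ↔ s b) :
    4 ≤ (changes k S s).card := by
  classical
  obtain ⟨c₁, m₁, c₂, m₂, c₃, m₃, h1, h12, h23, h3, h33⟩ := h.exists_three hk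
  have hw : ¬ (s (w 0) ↔ s (w 3)) := by
    have := h.2.2.2.2; tauto
  -- The labels of `w 0` and `w 3` differ while those of the extremes agree, so a further change
  -- occurs before `w 0` or after `w 3`.
  have key : ∃ c ∈ changes k S s, k c.1 < k c₁.1 ∨ k c₃.1 < k c.1 := by
    by_cases hs : s a ↔ s (w 0)
    · have hs' : ¬ (s (w 3) ↔ s b) := by tauto
      have hlt : k (w 3) < k b := by
        refine lt_of_le_of_ne (hmax _ (h.1 3)) fun e => hs' ?_
        rw [hk (h.1 3) hb e]
      obtain ⟨c, m, x, y, z⟩ := exists_mem_changes k S hk s (h.1 3) hb hlt hs'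
      exact ⟨c, m, Or.inr (h33.trans_le (h3.trans x))⟩
    · have hlt : k a < k (w 0) := by
        refine lt_of_le_of_ne (hmin _ (h.1 0)) fun e => hs ?_
        rw [hk ha (h.1 0) e]
      obtain ⟨c, m, x, y, z⟩ := exists_mem_changes k S hk s ha (h.1 0) hlt hs
      exact ⟨c, m, Or.inl (y.trans_le (z.trans h1))⟩
  obtain ⟨c, m, hc⟩ := key
  have : ({c, c₁, c₂, c₃} : Finset (ι × ι)) ⊆ changes k S s := by
    intro x; simp only [Finset.mem_insert, Finset.mem_singleton]
    rintro (rfl | rfl | rfl | rfl) <;> assumption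
  refine le_trans (le_of_eq ?_) (Finset.card_le_card this)
  rw [Finset.card_insert_of_notMem, Finset.card_eq_three.2 ⟨c₁, c₂, c₃, ?_, ?_, ?_, rfl⟩]
  · rintro rfl; exact h12.ne rfl
  · rintro rfl; exact (h12.trans h23).ne rfl
  · rintro rfl; exact h23.ne rfl
  · simp only [Finset.mem_insert, Finset.mem_singleton]
    rintro (rfl | rfl | rfl)
    · rcases hc with hc | hc
      · exact hc.ne rfl
      · exact (h12.trans h23).not_gt hc
    · rcases hc with hc | hc
      · exact h12.not_gt hc
      · exact h23.not_gt hc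
    · rcases hc with hc | hc
      · exact (h12.trans h23).not_gt hc
      · exact hc.ne rfl

end Changes

/-! ### Ordering directions by angle -/

/-- A linear functional close to the first coordinate. -/
def height (ε : ℝ) (u : EuclideanSpace ℝ (Fin 2)) : ℝ := u 0 + ε * u 1

/-- The order of directions by angle, starting from the lower end of the right half-plane
`height ε > 0`. -/
noncomputable def angleKey (ε : ℝ) (u : EuclideanSpace ℝ (Fin 2)) : Lex (Bool × ℝ) :=
  toLex (decide (height ε u < 0), u 1 / height ε u)

lemma angleKey_lt_of_right_left {ε : ℝ} {u w : EuclideanSpace ℝ (Fin 2)} (hu : 0 < height ε u)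
    (hw : height ε w < 0) : angleKey ε u < angleKey ε w := by
  simp [angleKey, Prod.Lex.toLex_lt_toLex, hw, not_lt.2 hu.le]

lemma cross_eq_height (ε : ℝ) (u w : EuclideanSpace ℝ (Fin 2)) :
    cross u w = height ε u * w 1 - u 1 * height ε w := by
  simp [cross, height]; ring

lemma angleKey_lt_iff {ε : ℝ} {u w : EuclideanSpace ℝ (Fin 2)}
    (h : 0 < height ε u * height ε w) : angleKey ε u < angleKey ε w ↔ 0 < cross u w := by
  rw [cross_eq_height ε]
  have hu : height ε u ≠ 0 := left_ne_zero_of_mul h.ne'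
  have hw : height ε w ≠ 0 := right_ne_zero_of_mul h.ne'
  have hside : decide (height ε u < 0) = decide (height ε w < 0) := by
    rw [decide_eq_decide]
    constructor <;> intro h' <;> by_contra hc <;> nlinarith
  simp only [angleKey, Prod.Lex.toLex_lt_toLex, hside, lt_irrefl, true_and, false_or]
  rw [← sub_pos, div_sub_div _ _ hw hu, div_pos_iff_of_pos_right (by linarith)]
  constructor <;> intro h' <;> linarith

lemma angleKey_inj {ε : ℝ} {u w : EuclideanSpace ℝ (Fin 2)} (hu : height ε u ≠ 0)
    (hw : height ε w ≠ 0) (h : angleKey ε u = angleKey ε w) :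
    cross u w = 0 ∧ 0 < height ε u * height ε w := by
  simp only [angleKey, EmbeddingLike.apply_eq_iff_eq, Prod.mk.injEq, decide_eq_decide] at h
  refine ⟨?_, ?_⟩
  · rw [cross_eq_height ε]
    have := h.2
    rw [div_eq_div_iff hu hw] at this
    linarith
  · rcases hu.lt_or_gt with h' | h'
    · exact mul_pos_of_neg_of_neg h' (h.1.1 h')
    · have : ¬ height ε w < 0 := fun h2 => (h.1.2 h2).not_gt h'
      exact mul_pos h' (lt_of_le_of_ne (not_lt.1 this) hw.symm)

/-- Cramer's rule for `e` in terms of `a` and `b`, with the height applied to it. It transfers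
betweenness of directions to signs of heights. -/
lemma cross_height (ε : ℝ) (a b e : EuclideanSpace ℝ (Fin 2)) :
    cross a b * height ε e = cross a e * height ε b + cross e b * height ε a := by
  simp [cross, height]; ring

end

/-! ### Corners at a vertex and label changes in angular order -/

section

variable {W : Type*}

lemma mem_openSegment_of_abs_height_lt {p : W → EuclideanSpace ℝ (Fin 2)} {ε : ℝ} {v w x : W}
    (hcross : cross (p w - p v) (p x - p v) = 0)
    (hside : 0 < height ε (p w - p v) * height ε (p x - p v))
    (hlt : |height ε (p w - p v)| < |height ε (p x - p v)|) :
    p w ∈ openSegment ℝ (p v) (p x) := by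
  set u := p w - p v with hu
  set u' := p x - p v with hu'
  have h0 : height ε u' ≠ 0 := right_ne_zero_of_mul hside.ne'
  set t := height ε u / height ε u' with ht
  have ht0 : 0 < t := by
    rw [ht, ← mul_div_mul_right _ _ h0]
    exact div_pos hside (mul_self_pos.2 h0)
  have ht1 : t < 1 := by
    have : |t| < 1 := by rw [ht, abs_div, div_lt_one (abs_pos.2 h0)]; exact hlt
    exact (abs_lt.1 this).2
  have hut : u = t • u' := by
    have e : height ε u = t * height ε u' := by rw [ht]; field_simp
    have e1 : u 1 = t * u' 1 := by
      rw [cross_eq_height ε] at hcross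
      have : height ε u' * (u 1 - t * u' 1) = 0 := by
        linear_combination -hcross + u' 1 * e
      rcases mul_eq_zero.1 this with h | h
      · exact absurd h h0
      · linarith
    have e0 : u 0 = t * u' 0 := by
      simp only [height] at e
      linear_combination e - ε * e1
    ext i; fin_cases i
    · simpa using e0
    · simpa using e1
  refine ⟨1 - t, t, by linarith, ht0, by ring, ?_⟩
  have : p w = p v + t • (p x - p v) := by rw [← hu', ← hut, hu]; abel
  rw [this]; module

/-- Equal keys mean the same ray from `v`: the nearer neighbour would lie on the edge to the farther
one, and equal distance is excluded by genericity of the height. -/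
lemma angleKey_injOn {p : W → EuclideanSpace ℝ (Fin 2)} {F : SimpleGraph W}
    (hF : IsPlaneDrawing p F) {ε : ℝ}
    (hε : ∀ v w, v ≠ w → height ε (p w - p v) ≠ 0) (v : W) :
    Set.InjOn (fun w => angleKey ε (p w - p v)) {w | F.Adj v w} := by
  intro w hw x hx h
  obtain ⟨hc, hs⟩ := angleKey_inj (hε _ _ (SimpleGraph.Adj.ne hw))
    (hε _ _ (SimpleGraph.Adj.ne hx)) h
  rcases lt_trichotomy |height ε (p w - p v)| |height ε (p x - p v)| with hlt | heq | hlt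
  · exact absurd (mem_openSegment_of_abs_height_lt hc hs hlt) (hF.vertex _ _ _ hx)
  · by_contra hne
    apply hε w x hne
    have he : height ε (p w - p v) = height ε (p x - p v) := by
      rcases abs_eq_abs.1 heq with e | e
      · exact e
      · rw [e] at hs; nlinarith [sq_nonneg (height ε (p x - p v))]
    have : height ε (p x - p w) = height ε (p x - p v) - height ε (p w - p v) := by
      simp [height]; ring
    rw [this, he, sub_self]
  · refine absurd (mem_openSegment_of_abs_height_lt (p := p) ?_ ?_ hlt) (hF.vertex _ _ _ hw)
    · rw [cross_swap, hc, neg_zero]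
    · rwa [mul_comm]

section Corners

variable {p : W → EuclideanSpace ℝ (Fin 2)} {F : SimpleGraph W} {ε : ℝ}

/-- Within one open half-plane consecutive directions make an angle less than π, and a direction
inside that angle stays in the half-plane, where key order is counterclockwise order. -/
lemma isCorner_of_same_side {v c d : W} (hc : F.Adj v c) (hd : F.Adj v d)
    (hs : 0 < height ε (p c - p v) * height ε (p d - p v))
    (hlt : angleKey ε (p c - p v) < angleKey ε (p d - p v))
    (hno : ∀ e, F.Adj v e → ¬ (angleKey ε (p c - p v) < angleKey ε (p e - p v) ∧
      angleKey ε (p e - p v) < angleKey ε (p d - p v))) : IsCorner p F v c d := by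
  have hD := (angleKey_lt_iff hs).1 hlt
  refine ⟨hc, hd, hD, ?_⟩
  rintro e he ⟨h1, h2⟩
  have hid := cross_height ε (p c - p v) (p d - p v) (p e - p v)
  have : 0 < height ε (p c - p v) * height ε (p e - p v) := by
    have hcc : 0 < height ε (p c - p v) * height ε (p c - p v) :=
      mul_self_pos.2 (left_ne_zero_of_mul hs.ne')
    refine pos_of_mul_pos_right (a := cross (p c - p v) (p d - p v)) ?_ hD.le
    have : cross (p c - p v) (p d - p v) * (height ε (p c - p v) * height ε (p e - p v))
        = cross (p c - p v) (p e - p v) * (height ε (p c - p v) * height ε (p d - p v))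
          + cross (p e - p v) (p d - p v) * (height ε (p c - p v) * height ε (p c - p v)) := by
      linear_combination height ε (p c - p v) * hid
    rw [this]; positivity
  refine hno e he ⟨(angleKey_lt_iff this).2 h1, (angleKey_lt_iff ?_).2 h2⟩
  by_contra hcon
  push Not at hcon
  have a := mul_pos this hs
  have b := mul_nonpos_of_nonpos_of_nonneg hcon (mul_self_nonneg (height ε (p c - p v)))
  linarith

lemma no_between_of_isCorner_right_left {v a b : W}
    (hε : ∀ v w, v ≠ w → height ε (p w - p v) ≠ 0) (h : IsCorner p F v a b)
    (ha : 0 < height ε (p a - p v)) (hb : height ε (p b - p v) < 0) (e : W) (he : F.Adj v e) :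
    ¬ (angleKey ε (p a - p v) < angleKey ε (p e - p v) ∧
      angleKey ε (p e - p v) < angleKey ε (p b - p v)) := by
  rintro ⟨h1, h2⟩
  have hid := cross_height ε (p a - p v) (p b - p v) (p e - p v)
  have hD := h.2.2.1
  rcases (hε v e he.ne).lt_or_gt with hl | hr
  · have x2 := (angleKey_lt_iff (mul_pos_of_neg_of_neg hl hb)).1 h2
    refine h.2.2.2 e he ⟨?_, x2⟩
    by_contra hcon
    push Not at hcon
    have := mul_neg_of_pos_of_neg hD hl
    have := mul_nonneg_of_nonpos_of_nonpos hcon hb.le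
    have := mul_pos x2 ha
    linarith
  · have x1 := (angleKey_lt_iff (mul_pos ha hr)).1 h1
    refine h.2.2.2 e he ⟨x1, ?_⟩
    by_contra hcon
    push Not at hcon
    have := mul_pos hD hr
    have := mul_neg_of_pos_of_neg x1 hb
    have := mul_nonpos_of_nonpos_of_nonneg hcon ha.le
    linarith

/-- Such a corner contains the ray where the linear order is cut open, so it joins the last
neighbour to the first. -/
lemma extreme_of_isCorner_left_right {v a b : W}
    (hε : ∀ v w, v ≠ w → height ε (p w - p v) ≠ 0) (h : IsCorner p F v a b)
    (ha : height ε (p a - p v) < 0) (hb : 0 < height ε (p b - p v)) (e : W) (he : F.Adj v e) :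
    angleKey ε (p b - p v) ≤ angleKey ε (p e - p v) ∧
      angleKey ε (p e - p v) ≤ angleKey ε (p a - p v) := by
  have hid := cross_height ε (p a - p v) (p b - p v) (p e - p v)
  have hD := h.2.2.1
  rcases (hε v e he.ne).lt_or_gt with hl | hr
  · refine ⟨(angleKey_lt_of_right_left hb hl).le, ?_⟩
    by_contra hcon
    push Not at hcon
    have x1 := (angleKey_lt_iff (mul_pos_of_neg_of_neg ha hl)).1 hcon
    refine h.2.2.2 e he ⟨x1, ?_⟩
    by_contra hcon'
    push Not at hcon'
    have := mul_neg_of_pos_of_neg hD hl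
    have := mul_pos x1 hb
    have := mul_nonneg_of_nonpos_of_nonpos hcon' ha.le
    linarith
  · refine ⟨?_, (angleKey_lt_of_right_left hr ha).le⟩
    by_contra hcon
    push Not at hcon
    have x1 := (angleKey_lt_iff (mul_pos hr hb)).1 hcon
    refine h.2.2.2 e he ⟨?_, x1⟩
    by_contra hcon'
    push Not at hcon'
    have := mul_pos hD hr
    have := mul_nonpos_of_nonpos_of_nonneg hcon' hb.le
    have := mul_neg_of_pos_of_neg x1 ha
    linarith

variable [Fintype W]

open Classical in
/-- If the labels of the edges at `v` alternate at least four times, then at least two corners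
at `v` have different labels, and at least twice as many as those whose sides are on different
sides of `v`. -/
lemma two_le_card_changing_corners (hF : IsPlaneDrawing p F)
    (hε : ∀ v w, v ≠ w → height ε (p w - p v) ≠ 0) (v : W) (s : W → Prop) {w : Fin 4 → W}
    (hw : Alternating (fun x => angleKey ε (p x - p v)) (Finset.univ.filter (F.Adj v)) s w) :
    2 ≤ (Finset.univ.filter fun c : W × W =>
        IsCorner p F v c.1 c.2 ∧ ¬ (s c.1 ↔ s c.2)).card ∧
      2 * (Finset.univ.filter fun c : W × W => IsCorner p F v c.1 c.2 ∧
          height ε (p c.1 - p v) * height ε (p c.2 - p v) < 0).card ≤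
        (Finset.univ.filter fun c : W × W =>
          IsCorner p F v c.1 c.2 ∧ ¬ (s c.1 ↔ s c.2)).card := by
  set k : W → Lex (Bool × ℝ) := fun x => angleKey ε (p x - p v) with hk
  set N := Finset.univ.filter (F.Adj v) with hN
  set K := Finset.univ.filter fun c : W × W => IsCorner p F v c.1 c.2 ∧ ¬ (s c.1 ↔ s c.2) with hK
  set M := Finset.univ.filter fun c : W × W => IsCorner p F v c.1 c.2 ∧
    height ε (p c.1 - p v) * height ε (p c.2 - p v) < 0 with hM
  have memN : ∀ x, x ∈ N ↔ F.Adj v x := by simp [hN]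
  have hkinj : Set.InjOn k N := by
    have : (N : Set W) = {w | F.Adj v w} := by ext; simp [hN]
    rw [this]; exact angleKey_injOn hF hε v
  have memC : ∀ c, c ∈ changes k N s ↔ (F.Adj v c.1 ∧ F.Adj v c.2) ∧ k c.1 < k c.2 ∧
      ¬ (s c.1 ↔ s c.2) ∧ ∀ e, F.Adj v e → ¬ (k c.1 < k e ∧ k e < k c.2) := by
    intro c; simp [changes, memN]
  have hCK : ∀ c ∈ changes k N s, ¬ (0 < height ε (p c.1 - p v) ∧ height ε (p c.2 - p v) < 0) →
      c ∈ K := by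
    intro c hc hside
    obtain ⟨⟨h1, h2⟩, hlt, hs, hno⟩ := (memC c).1 hc
    simp only [hK, Finset.mem_filter, Finset.mem_univ, true_and]
    refine ⟨isCorner_of_same_side h1 h2 ?_ hlt hno, hs⟩
    rcases (hε v c.1 h1.ne).lt_or_gt with hl | hr
    · rcases (hε v c.2 h2.ne).lt_or_gt with hl' | hr'
      · exact mul_pos_of_neg_of_neg hl hl'
      · exact absurd hlt (angleKey_lt_of_right_left hr' hl).not_gt
    · rcases (hε v c.2 h2.ne).lt_or_gt with hl' | hr'
      · exact absurd ⟨hr, hl'⟩ hside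
      · exact mul_pos hr hr'
  have huniq : ∀ a b a' b', F.Adj v a → F.Adj v b → F.Adj v a' → F.Adj v b' →
      0 < height ε (p a - p v) → height ε (p b - p v) < 0 →
      0 < height ε (p a' - p v) → height ε (p b' - p v) < 0 →
      (∀ e, F.Adj v e → ¬ (k a < k e ∧ k e < k b)) →
      (∀ e, F.Adj v e → ¬ (k a' < k e ∧ k e < k b')) → a = a' ∧ b = b' := by
    intro a b a' b' ha hb ha' hb' ra lb ra' lb' hno hno'
    constructor
    · refine hkinj ((memN _).2 ha) ((memN _).2 ha') (le_antisymm ?_ ?_)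
      · exact not_lt.1 fun h => hno' a ha ⟨h, angleKey_lt_of_right_left ra lb'⟩
      · exact not_lt.1 fun h => hno a' ha' ⟨h, angleKey_lt_of_right_left ra' lb⟩
    · refine hkinj ((memN _).2 hb) ((memN _).2 hb') (le_antisymm ?_ ?_)
      · exact not_lt.1 fun h => hno b' hb' ⟨angleKey_lt_of_right_left ra lb', h⟩
      · exact not_lt.1 fun h => hno' b hb ⟨angleKey_lt_of_right_left ra' lb, h⟩
  set X := (changes k N s).filter
    fun c => 0 < height ε (p c.1 - p v) ∧ height ε (p c.2 - p v) < 0 with hX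
  have hXcard : X.card ≤ 1 := by
    rw [Finset.card_le_one]
    intro c hc d hd
    simp only [hX, Finset.mem_filter, memC] at hc hd
    have := huniq _ _ _ _ hc.1.1.1 hc.1.1.2 hd.1.1.1 hd.1.1.2 hc.2.1 hc.2.2 hd.2.1 hd.2.2
      hc.1.2.2.2 hd.1.2.2.2
    exact Prod.ext this.1 this.2
  -- Of at least three changes, only the gap from the right to the left half-plane can fail to be a
  -- corner, since its angle may reach π.
  have hK2 : 2 ≤ K.card := by
    have h3 := hw.three_le hkinj
    have hle : ((changes k N s).filter
        fun c => ¬ (0 < height ε (p c.1 - p v) ∧ height ε (p c.2 - p v) < 0)).card ≤ K.card := by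
      refine Finset.card_le_card fun c hc => ?_
      rw [Finset.mem_filter] at hc
      exact hCK c hc.1 hc.2
    have := Finset.card_filter_add_card_filter_not (s := changes k N s)
      (fun c => 0 < height ε (p c.1 - p v) ∧ height ε (p c.2 - p v) < 0)
    rw [← hX] at this
    omega
  refine ⟨hK2, ?_⟩
  have memM : ∀ c, c ∈ M ↔ IsCorner p F v c.1 c.2 ∧
    height ε (p c.1 - p v) * height ε (p c.2 - p v) < 0 := by simp [hM]
  have hMsplit := Finset.card_filter_add_card_filter_not (s := M)
    (fun c => 0 < height ε (p c.1 - p v))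
  have hup : ∀ c ∈ M.filter (fun c => 0 < height ε (p c.1 - p v)), IsCorner p F v c.1 c.2 ∧
      0 < height ε (p c.1 - p v) ∧ height ε (p c.2 - p v) < 0 := by
    intro c hc
    rw [Finset.mem_filter, memM] at hc
    exact ⟨hc.1.1, hc.2, (pos_iff_neg_of_mul_neg hc.1.2).1 hc.2⟩
  have hdn : ∀ c ∈ M.filter (fun c => ¬ 0 < height ε (p c.1 - p v)), IsCorner p F v c.1 c.2 ∧
      height ε (p c.1 - p v) < 0 ∧ 0 < height ε (p c.2 - p v) := by
    intro c hc
    rw [Finset.mem_filter, memM] at hc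
    have : height ε (p c.1 - p v) < 0 :=
      lt_of_le_of_ne (not_lt.1 hc.2) (hε _ _ hc.1.1.1.ne)
    exact ⟨hc.1.1, this, (neg_iff_pos_of_mul_neg hc.1.2).1 this⟩
  have hup1 : (M.filter (fun c => 0 < height ε (p c.1 - p v))).card ≤ 1 := by
    rw [Finset.card_le_one]
    intro c hc d hd
    obtain ⟨c1, c2, c3⟩ := hup c hc
    obtain ⟨d1, d2, d3⟩ := hup d hd
    have := huniq _ _ _ _ c1.1 c1.2.1 d1.1 d1.2.1 c2 c3 d2 d3
      (no_between_of_isCorner_right_left hε c1 c2 c3)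
      (no_between_of_isCorner_right_left hε d1 d2 d3)
    exact Prod.ext this.1 this.2
  have hdn1 : (M.filter (fun c => ¬ 0 < height ε (p c.1 - p v))).card ≤ 1 := by
    rw [Finset.card_le_one]
    intro c hc d hd
    obtain ⟨c1, c2, c3⟩ := hdn c hc
    obtain ⟨d1, d2, d3⟩ := hdn d hd
    have hc' := extreme_of_isCorner_left_right hε c1 c2 c3
    have hd' := extreme_of_isCorner_left_right hε d1 d2 d3
    refine Prod.ext (hkinj ((memN _).2 c1.1) ((memN _).2 d1.1) ?_)
      (hkinj ((memN _).2 c1.2.1) ((memN _).2 d1.2.1) ?_)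
    · exact le_antisymm (hd' _ c1.1).2 (hc' _ d1.1).2
    · exact le_antisymm (hc' _ d1.2.1).1 (hd' _ c1.2.1).1
  -- If one half of `M` is empty then `M` has at most one element and `hK2` suffices. Otherwise both
  -- gaps between the half-planes are corners, every change is a corner, and four of them are
  -- needed.
  by_cases hU : (M.filter (fun c => 0 < height ε (p c.1 - p v))).card = 0
  · omega
  by_cases hV : (M.filter (fun c => ¬ 0 < height ε (p c.1 - p v))).card = 0
  · omega
  obtain ⟨c, hc⟩ := Finset.card_ne_zero.1 hU
  obtain ⟨d, hd⟩ := Finset.card_ne_zero.1 hV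
  obtain ⟨c1, c2, c3⟩ := hup c hc
  obtain ⟨d1, d2, d3⟩ := hdn d hd
  have hsub : changes k N s ⊆ K := by
    intro x hx
    by_cases hside : 0 < height ε (p x.1 - p v) ∧ height ε (p x.2 - p v) < 0
    · obtain ⟨⟨h1, h2⟩, hlt, hs, hno⟩ := (memC x).1 hx
      have := huniq _ _ _ _ h1 h2 c1.1 c1.2.1 hside.1 hside.2 c2 c3 hno
        (no_between_of_isCorner_right_left hε c1 c2 c3)
      have hxc : x = c := Prod.ext this.1 this.2
      simp only [hK, Finset.mem_filter, Finset.mem_univ, true_and]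
      exact ⟨hxc ▸ c1, hs⟩
    · exact hCK x hx hside
  have hext := extreme_of_isCorner_left_right hε d1 d2 d3
  have hK4 : 4 ≤ K.card := by
    -- `d` runs from the last neighbour to the first. If their labels agree, the linear order
    -- already shows four changes; if not, `d` is a fourth one which `changes` does not see.
    by_cases hs : s d.2 ↔ s d.1
    · exact (hw.four_le hkinj ((memN _).2 d1.2.1) ((memN _).2 d1.1)
        (fun e he => (hext e ((memN _).1 he)).1) (fun e he => (hext e ((memN _).1 he)).2) hs).trans
        (Finset.card_le_card hsub)
    · have hnot : d ∉ changes k N s := by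
        intro h
        exact ((memC d).1 h).2.1.not_ge (hext _ d1.1).1
      have hins : insert d (changes k N s) ⊆ K := by
        refine Finset.insert_subset ?_ hsub
        simp only [hK, Finset.mem_filter, Finset.mem_univ, true_and]
        exact ⟨d1, fun h => hs h.symm⟩
      have := Finset.card_le_card hins
      rw [Finset.card_insert_of_notMem hnot] at this
      have := hw.three_le hkinj
      omega
  omega

end Corners

end

/-! ### Cauchy's lemma by double counting -/

section

variable {W : Type*}

lemma height_sub (ε : ℝ) (u w : EuclideanSpace ℝ (Fin 2)) :
    height ε (u - w) = height ε u - height ε w := by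
  simp [height]; ring

lemma exists_generic_height [Finite W] {p : W → EuclideanSpace ℝ (Fin 2)}
    (hp : Function.Injective p) : ∃ ε : ℝ, ∀ v w, v ≠ w → height ε (p w - p v) ≠ 0 := by
  have hfin : (Set.range fun c : W × W => -(p c.2 - p c.1) 0 / (p c.2 - p c.1) 1).Finite :=
    Set.finite_range _
  obtain ⟨ε, hε⟩ := hfin.exists_notMem
  refine ⟨ε, fun v w hvw h0 => ?_⟩
  simp only [height] at h0
  by_cases h1 : (p w - p v) 1 = 0
  · apply hvw
    refine hp (sub_eq_zero.1 ?_).symm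
    ext i; fin_cases i
    · simpa [h1] using h0
    · simpa using h1
  · refine hε ⟨(v, w), ?_⟩
    simp only
    rw [div_eq_iff h1]
    linarith

/-- Cyclic rotation of triples. -/
def rotateTriple (W : Type*) : W × W × W ≃ W × W × W where
  toFun t := (t.2.1, t.2.2, t.1)
  invFun t := (t.2.2, t.1, t.2.1)
  left_inv _ := rfl
  right_inv _ := rfl

lemma Alternating.mono {ι κ : Type*} [LinearOrder κ] {k : ι → κ} {S T : Finset ι} {s : ι → Prop}
    {w : Fin 4 → ι} (h : Alternating k S s w) (hST : S ⊆ T) : Alternating k T s w :=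
  ⟨fun i => hST (h.1 i), h.2⟩

open Classical in
/-- Cauchy's lemma for straight-line plane graphs: if the edges are labelled by two signs, then
there is a vertex around which the sign changes less than four times. -/
theorem exists_not_alternating [Fintype W] [Nonempty W] {p : W → EuclideanSpace ℝ (Fin 2)}
    (hp : Function.Injective p) {F₀ : SimpleGraph W} (hF₀ : IsPlaneDrawing p F₀)
    {s : W → W → Prop} (hs : ∀ v w, s v w ↔ s w v) {ε : ℝ}
    (hε : ∀ v w, v ≠ w → height ε (p w - p v) ≠ 0) :
    ∃ v, ∀ w, ¬ Alternating (fun x => angleKey ε (p x - p v))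
      (Finset.univ.filter (F₀.Adj v)) (s v) w := by
  by_contra hcon
  push Not at hcon
  obtain ⟨F, hle, hF⟩ := (Set.toFinite {F : SimpleGraph W | IsPlaneDrawing p F}).exists_le_maximal
    (show F₀ ∈ {F : SimpleGraph W | IsPlaneDrawing p F} from hF₀)
  change Maximal (IsPlaneDrawing p) F at hF
  choose w hw using hcon
  have hsub : ∀ v, Finset.univ.filter (F₀.Adj v) ⊆ Finset.univ.filter (F.Adj v) :=
    fun v => Finset.monotone_filter_right _ fun _ _ h => hle h
  have hcount := fun v => two_le_card_changing_corners hF.prop hε v (s v) ((hw v).mono (hsub v))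
  set g : W × W × W → ℕ := fun t =>
    if IsCorner p F t.1 t.2.1 t.2.2 ∧ ¬ (s t.1 t.2.1 ↔ s t.1 t.2.2) then 1 else 0 with hg
  set m : W × W × W → ℕ := fun t => if IsCorner p F t.1 t.2.1 t.2.2 ∧
    height ε (p t.2.1 - p t.1) * height ε (p t.2.2 - p t.1) < 0 then 1 else 0 with hm
  have hcount' : ∀ v, 2 ≤ ∑ c : W × W, g (v, c) ∧
      2 * ∑ c : W × W, m (v, c) ≤ ∑ c : W × W, g (v, c) := by
    intro v
    have := hcount v
    rwa [Finset.card_filter, Finset.card_filter] at this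
  -- Per triangle: one corner is at the vertex of middle height (`hmid`), and two of the three sides
  -- share a label (`hχ`), so at most two corners change sign.
  have hpoint : ∀ t, g t + g (rotateTriple W t) + g (rotateTriple W (rotateTriple W t)) ≤
      2 * (m t + m (rotateTriple W t) + m (rotateTriple W (rotateTriple W t))) := by
    rintro ⟨v, a, b⟩
    simp only [hg, hm, rotateTriple, Equiv.coe_fn_mk]
    by_cases h : IsCorner p F v a b
    · have h1 := h.rotate hp hF
      have h2 := h1.rotate hp hF
      simp only [h, h1, h2, true_and]
      have hmid : height ε (p a - p v) * height ε (p b - p v) < 0 ∨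
          height ε (p b - p a) * height ε (p v - p a) < 0 ∨
          height ε (p v - p b) * height ε (p a - p b) < 0 := by
        have d1 := hε v a h.1.ne
        have d2 := hε v b h.2.1.ne
        have d3 := hε a b h1.1.ne
        simp only [height_sub] at *
        by_contra hc
        push Not at hc
        obtain ⟨c1, c2, c3⟩ := hc
        rcases d1.lt_or_gt with x | x <;> rcases d2.lt_or_gt with y | y <;>
          rcases d3.lt_or_gt with z | z <;> nlinarith
      have hχ : (s v a ↔ s v b) ∨ (s a b ↔ s a v) ∨ (s b v ↔ s b a) := by
        have := hs v a; have := hs v b; have := hs a b; tauto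
      have h3 : (if ¬ (s v a ↔ s v b) then 1 else 0) + (if ¬ (s a b ↔ s a v) then 1 else 0) +
          (if ¬ (s b v ↔ s b a) then 1 else 0) ≤ 2 := by
        rcases hχ with h | h | h <;> simp only [h, not_true_eq_false, if_false] <;> split_ifs <;>
          norm_num
      refine h3.trans ?_
      rcases hmid with h | h | h <;> simp only [h, if_true] <;> omega
    · have h1 : ¬ IsCorner p F a b v := fun hc => h ((hc.rotate hp hF).rotate hp hF)
      have h2 : ¬ IsCorner p F b v a := fun hc => h (hc.rotate hp hF)
      simp [h, h1, h2]
  have hsum := Finset.sum_le_sum fun t (_ : t ∈ Finset.univ) => hpoint t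
  have e2 : ∀ f : W × W × W → ℕ, ∑ t, f (rotateTriple W (rotateTriple W t)) = ∑ t, f t := by
    intro f
    rw [(rotateTriple W).sum_comp fun t => f (rotateTriple W t), (rotateTriple W).sum_comp f]
  rw [Finset.sum_add_distrib, Finset.sum_add_distrib, ← Finset.mul_sum, Finset.sum_add_distrib,
    Finset.sum_add_distrib, e2, e2, (rotateTriple W).sum_comp g, (rotateTriple W).sum_comp m,
    Fintype.sum_prod_type, Fintype.sum_prod_type] at hsum
  -- Strictness comes from the lowest vertex: all its edges go up, so none of its corners is a
  -- middle one, yet two of them change sign.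
  have hlt : ∑ v, 2 * ∑ c : W × W, m (v, c) < ∑ v, ∑ c : W × W, g (v, c) := by
    obtain ⟨v, -, hv⟩ := Finset.univ.exists_min_image (fun v => height ε (p v))
      Finset.univ_nonempty
    refine Finset.sum_lt_sum (fun v _ => (hcount' v).2) ⟨v, Finset.mem_univ _, ?_⟩
    have : ∑ c : W × W, m (v, c) = 0 := by
      refine Finset.sum_eq_zero fun c _ => ?_
      simp only [hm]
      rw [if_neg]
      rintro ⟨-, h⟩
      rw [height_sub, height_sub] at h
      have := mul_nonneg (sub_nonneg.2 (hv c.1 (Finset.mem_univ _)))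
        (sub_nonneg.2 (hv c.2 (Finset.mem_univ _)))
      linarith
    have := (hcount' v).1
    omega
  rw [← Finset.mul_sum] at hlt
  omega

end

/-! ### Affine dependences of points in convex position -/

section

lemma inner_eq_coords (z u : EuclideanSpace ℝ (Fin 2)) : ⟪z, u⟫ = z 0 * u 0 + z 1 * u 1 := by
  simp [PiLp.inner_apply, Fin.sum_univ_two, mul_comm]

lemma cross_mul_cross (d e u w : EuclideanSpace ℝ (Fin 2)) :
    cross d e * cross u w = ⟪d, u⟫ * ⟪e, w⟫ - ⟪d, w⟫ * ⟪e, u⟫ := by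
  simp only [inner_eq_coords, cross]; ring

/-- A strictly monotone map of directions preserves the orientation of triples. -/
lemma cross_pos_of_strictMono {u₁ u₂ u₃ z₁ z₂ z₃ : EuclideanSpace ℝ (Fin 2)}
    (h12 : 0 < cross u₁ u₂) (h23 : 0 < cross u₂ u₃)
    (m12 : ⟪z₂, u₁⟫ < ⟪z₁, u₁⟫) (m13 : ⟪z₃, u₁⟫ < ⟪z₁, u₁⟫)
    (m21 : ⟪z₁, u₂⟫ < ⟪z₂, u₂⟫) (m23 : ⟪z₃, u₂⟫ < ⟪z₂, u₂⟫)
    (m31 : ⟪z₁, u₃⟫ < ⟪z₃, u₃⟫) (m32 : ⟪z₂, u₃⟫ < ⟪z₃, u₃⟫) :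
    0 < cross (z₂ - z₁) (z₃ - z₁) := by
  have e1 := cross_mul_cross (z₂ - z₁) (z₃ - z₂) u₁ u₂
  have e2 := cross_mul_cross (z₂ - z₁) (z₃ - z₂) u₂ u₃
  have e3 : cross (z₂ - z₁) (z₃ - z₁) = cross (z₂ - z₁) (z₃ - z₂) := by
    simp [cross]; ring
  rw [e3]
  simp only [inner_sub_left] at e1 e2
  set A := ⟪z₂, u₂⟫ - ⟪z₁, u₂⟫ with hA
  have hA0 : 0 < A := sub_pos.2 m21
  have hC0 : 0 < ⟪z₂, u₂⟫ - ⟪z₃, u₂⟫ := sub_pos.2 m23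
  rcases le_total A (⟪z₂, u₂⟫ - ⟪z₃, u₂⟫) with hAC | hAC
  · refine pos_of_mul_pos_left (b := cross u₁ u₂) ?_ h12.le
    rw [e1]
    have p1 := mul_nonneg (sub_nonneg.2 hAC) (sub_pos.2 m12).le
    have p2 := mul_pos hA0 (sub_pos.2 m13)
    linarith
  · refine pos_of_mul_pos_left (b := cross u₂ u₃) ?_ h23.le
    rw [e2]
    have p1 := mul_nonneg (sub_nonneg.2 hAC) (sub_pos.2 m32).le
    have p2 := mul_pos hC0 (sub_pos.2 m31)
    linarith

/-- At most one of the three cyclic gaps between the directions reaches π. Starting after that gap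
puts the triple in the situation of `cross_pos_of_strictMono`, and orientation is invariant under
cyclic rotation. -/
lemma cross_pos_of_angleKey_lt {ε : ℝ} {w₁ w₂ w₃ z₁ z₂ z₃ : EuclideanSpace ℝ (Fin 2)}
    (h1 : height ε w₁ ≠ 0) (h2 : height ε w₂ ≠ 0) (h3 : height ε w₃ ≠ 0)
    (k12 : angleKey ε w₁ < angleKey ε w₂) (k23 : angleKey ε w₂ < angleKey ε w₃)
    (m12 : ⟪z₂, -w₁⟫ < ⟪z₁, -w₁⟫) (m13 : ⟪z₃, -w₁⟫ < ⟪z₁, -w₁⟫)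
    (m21 : ⟪z₁, -w₂⟫ < ⟪z₂, -w₂⟫) (m23 : ⟪z₃, -w₂⟫ < ⟪z₂, -w₂⟫)
    (m31 : ⟪z₁, -w₃⟫ < ⟪z₃, -w₃⟫) (m32 : ⟪z₂, -w₃⟫ < ⟪z₃, -w₃⟫) :
    0 < cross (z₂ - z₁) (z₃ - z₁) := by
  have r1 : cross (z₃ - z₂) (z₁ - z₂) = cross (z₂ - z₁) (z₃ - z₁) := cross_rotate _ _ _
  have r2 : cross (z₁ - z₃) (z₂ - z₃) = cross (z₂ - z₁) (z₃ - z₁) :=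
    (cross_rotate _ _ _).trans r1
  have case12 : 0 < cross w₁ w₂ → 0 < cross w₂ w₃ → 0 < cross (z₂ - z₁) (z₃ - z₁) := by
    intro c1 c2
    rw [← cross_neg_neg] at c1 c2
    exact cross_pos_of_strictMono c1 c2 m12 m13 m21 m23 m31 m32
  have case23 : 0 < cross w₂ w₃ → 0 < cross w₃ w₁ → 0 < cross (z₂ - z₁) (z₃ - z₁) := by
    intro c1 c2
    rw [← cross_neg_neg] at c1 c2
    rw [← r1]
    exact cross_pos_of_strictMono c1 c2 m23 m21 m32 m31 m12 m13
  have case31 : 0 < cross w₃ w₁ → 0 < cross w₁ w₂ → 0 < cross (z₂ - z₁) (z₃ - z₁) := by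
    intro c1 c2
    rw [← cross_neg_neg] at c1 c2
    rw [← r2]
    exact cross_pos_of_strictMono c1 c2 m31 m32 m13 m12 m23 m21
  have hid := cross_height ε w₁ w₂ w₃
  have hid' := cross_height ε w₂ w₃ w₁
  have s13 := cross_swap w₁ w₃
  have s23 := cross_swap w₂ w₃
  have s12 := cross_swap w₁ w₂
  rcases h1.lt_or_gt with x | x <;> rcases h2.lt_or_gt with y | y <;>
    rcases h3.lt_or_gt with z | z
  · exact case12 ((angleKey_lt_iff (mul_pos_of_neg_of_neg x y)).1 k12)
      ((angleKey_lt_iff (mul_pos_of_neg_of_neg y z)).1 k23)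
  · exact absurd k23 (angleKey_lt_of_right_left z y).not_gt
  · exact absurd k12 (angleKey_lt_of_right_left y x).not_gt
  · exact absurd k12 (angleKey_lt_of_right_left y x).not_gt
  · have c23 := (angleKey_lt_iff (mul_pos_of_neg_of_neg y z)).1 k23
    by_cases c : 0 < cross w₁ w₂
    · exact case12 c c23
    · refine case23 c23 ?_
      by_contra c'
      push Not at c c'
      have p1 := mul_pos c23 x
      have p2 := mul_nonneg_of_nonpos_of_nonpos c z.le
      have p3 := mul_nonneg_of_nonpos_of_nonpos c' y.le
      rw [s12] at hid'
      rw [s13] at p3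
      linarith
  · exact absurd k23 (angleKey_lt_of_right_left z y).not_gt
  · have c12 := (angleKey_lt_iff (mul_pos x y)).1 k12
    by_cases c : 0 < cross w₂ w₃
    · exact case12 c12 c
    · refine case31 ?_ c12
      by_contra c'
      push Not at c c'
      have p1 := mul_neg_of_pos_of_neg c12 z
      have p2 := mul_nonpos_of_nonpos_of_nonneg c x.le
      have p3 := mul_nonpos_of_nonpos_of_nonneg c' y.le
      rw [s23] at hid
      rw [s13] at p3
      linarith
  · exact case12 ((angleKey_lt_iff (mul_pos x y)).1 k12)
      ((angleKey_lt_iff (mul_pos y z)).1 k23)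

lemma sum_mul_affine_eq_zero {ι : Type*} {S : Finset ι} {b : ι → ℝ}
    {Z : ι → EuclideanSpace ℝ (Fin 2)} (hb : ∑ x ∈ S, b x = 0) (hbZ : ∑ x ∈ S, b x • Z x = 0)
    (α β γ : ℝ) : ∑ x ∈ S, b x * (α * Z x 0 + β * Z x 1 + γ) = 0 := by
  have h : ∀ i, ∑ x ∈ S, b x * Z x i = 0 := by
    intro i
    have := congrArg (fun z : EuclideanSpace ℝ (Fin 2) => z i) hbZ
    simpa using this
  have : ∀ x, b x * (α * Z x 0 + β * Z x 1 + γ)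
      = α * (b x * Z x 0) + β * (b x * Z x 1) + γ * b x := fun x => by ring
  simp only [this, Finset.sum_add_distrib, ← Finset.mul_sum, h, hb]
  ring

/-- The signs of an affine dependence between points in convex position alternate at least four
times along the convex curve. -/
lemma exists_alternating {ι κ : Type*} [LinearOrder κ] (k : ι → κ) (S : Finset ι)
    (hk : Set.InjOn k S) (hS : S.Nonempty) {b : ι → ℝ} {Z U : ι → EuclideanSpace ℝ (Fin 2)}
    (hb0 : ∀ x ∈ S, b x ≠ 0) (hb : ∑ x ∈ S, b x = 0) (hbZ : ∑ x ∈ S, b x • Z x = 0)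
    (hmono : ∀ i ∈ S, ∀ j ∈ S, i ≠ j → ⟪Z j, U i⟫ < ⟪Z i, U i⟫)
    (hor : ∀ i ∈ S, ∀ j ∈ S, ∀ l ∈ S, k i < k j → k j < k l →
      0 < cross (Z j - Z i) (Z l - Z i)) :
    ∃ w, Alternating k S (fun x => 0 < b x) w := by
  classical
  obtain ⟨a, ha, hamin⟩ := S.exists_min_image k hS
  have hsame : ∀ x ∈ S, (0 < b a ↔ 0 < b x) → 0 < b a * b x := by
    intro x hx h
    rcases (hb0 a ha).lt_or_gt with h' | h'
    · refine mul_pos_of_neg_of_neg h' (lt_of_le_of_ne (not_lt.1 fun h2 => ?_) (hb0 x hx))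
      exact h'.not_gt (h.2 h2)
    · exact mul_pos h' (h.1 h')
  have hdiff : ∀ x ∈ S, ¬ (0 < b a ↔ 0 < b x) → b a * b x < 0 := by
    intro x hx h
    rcases (hb0 a ha).lt_or_gt with h' | h' <;> rcases (hb0 x hx).lt_or_gt with h2 | h2
    · exact absurd (iff_of_false h'.not_gt h2.not_gt) h
    · exact mul_neg_of_neg_of_pos h' h2
    · exact mul_neg_of_pos_of_neg h' h2
    · exact absurd (iff_of_true h' h2) h
  -- No affine function can agree in sign with the dependence throughout and be nonzero at `a`,
  -- since the weighted sum of its values vanishes.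
  have hsep : ∀ α β γ : ℝ, (∀ x ∈ S, 0 ≤ (b a * b x) * (α * Z x 0 + β * Z x 1 + γ)) →
      ¬ 0 < (b a * b a) * (α * Z a 0 + β * Z a 1 + γ) := by
    intro α β γ h h'
    have h1 := sum_mul_affine_eq_zero hb hbZ α β γ
    have h2 := Finset.sum_pos' h ⟨a, ha, h'⟩
    simp only [mul_assoc, ← Finset.mul_sum] at h2
    rw [h1, mul_zero] at h2
    exact h2.ne rfl
  have haa : 0 < b a * b a := mul_self_pos.2 (hb0 a ha)
  set T := S.filter fun x => ¬ (0 < b a ↔ 0 < b x) with hT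
  have memT : ∀ x, x ∈ T ↔ x ∈ S ∧ ¬ (0 < b a ↔ 0 < b x) := by simp [hT]
  rcases T.eq_empty_or_nonempty with hTe | hTne
  · exfalso
    refine hsep 0 0 1 (fun x hx => ?_) (by simpa using hb0 a ha)
    have : x ∉ T := by simp [hTe]
    have := hsame x hx (by by_contra hc; exact this ((memT x).2 ⟨hx, hc⟩))
    linarith
  obtain ⟨i, hi, himin⟩ := T.exists_min_image k hTne
  obtain ⟨j, hj, hjmax⟩ := T.exists_max_image k hTne
  have hiS := ((memT i).1 hi).1
  have hjS := ((memT j).1 hj).1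
  have hai : k a < k i := by
    refine lt_of_le_of_ne (hamin i hiS) fun e => ((memT i).1 hi).2 ?_
    rw [hk ha hiS e]
  -- `i` and `j` are the first and last elements of sign opposite to `a`. An element of the sign of
  -- `a` between them completes an alternation; otherwise the opposite sign fills the whole stretch
  -- and a line cuts it off.
  by_cases hx : ∃ x ∈ S, k i < k x ∧ k x < k j ∧ (0 < b a ↔ 0 < b x)
  · obtain ⟨x, hxS, h1, h2, h3⟩ := hx
    have := ((memT i).1 hi).2
    have := ((memT j).1 hj).2
    refine ⟨![a, i, x, j], ?_, hai, h1, h2, ?_, ?_, ?_⟩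
    · intro l; fin_cases l <;> simpa
    · simpa
    · change ¬ (0 < b i ↔ 0 < b x); tauto
    · change ¬ (0 < b x ↔ 0 < b j); tauto
  exfalso
  -- For a single opposite element the cutting line is the supporting line at `Z i` with normal `U
  -- i`; otherwise it is the line through `Z i` and `Z j`.
  rcases (himin j hj).eq_or_lt with hij | hij
  · obtain rfl := hk hiS hjS hij
    have hval : ∀ x, -U i 0 * Z x 0 + -U i 1 * Z x 1 + ⟪Z i, U i⟫ = ⟪Z i, U i⟫ - ⟪Z x, U i⟫ := by
      intro x; simp only [inner_eq_coords]; ring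
    refine hsep (-U i 0) (-U i 1) ⟪Z i, U i⟫ (fun x hxS => ?_) ?_
    · rw [hval]
      by_cases hxi : x = i
      · subst hxi; simp
      · refine mul_nonneg (hsame x hxS ?_).le (sub_pos.2 (hmono i hiS x hxS (Ne.symm hxi))).le
        by_contra hc
        have hxT := (memT x).2 ⟨hxS, hc⟩
        exact hxi (hk hxS hiS (le_antisymm (hjmax x hxT) (himin x hxT)))
    · rw [hval]
      refine mul_pos haa (sub_pos.2 (hmono i hiS a ha ?_))
      rintro rfl; exact hai.ne rfl
  · set d := Z j - Z i with hd
    have hval : ∀ x, -d 1 * Z x 0 + d 0 * Z x 1 + (d 1 * Z i 0 - d 0 * Z i 1)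
        = cross d (Z x - Z i) := by
      intro x; simp only [cross, PiLp.sub_apply]; ring
    have hlow : ∀ x ∈ S, k x < k i → 0 < cross d (Z x - Z i) := by
      intro x hxS hlt
      rw [hd, cross_rotate]
      exact hor x hxS i hiS j hjS hlt hij
    refine hsep (-d 1) (d 0) (d 1 * Z i 0 - d 0 * Z i 1) (fun x hxS => ?_) ?_
    · rw [hval]
      rcases lt_trichotomy (k x) (k i) with h | h | h
      · refine mul_nonneg (hsame x hxS ?_).le (hlow x hxS h).le
        by_contra hc
        exact (himin x ((memT x).2 ⟨hxS, hc⟩)).not_gt h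
      · rw [hk hxS hiS h, sub_self, cross_zero_right, mul_zero]
      rcases lt_trichotomy (k x) (k j) with h' | h' | h'
      · refine mul_nonneg_of_nonpos_of_nonpos (hdiff x hxS fun hc => hx ⟨x, hxS, h, h', hc⟩).le ?_
        rw [cross_swap]
        exact neg_nonpos.2 (hor i hiS x hxS j hjS h h').le
      · rw [hk hxS hjS h', hd, cross_self, mul_zero]
      · refine mul_nonneg (hsame x hxS ?_).le (hor i hiS j hjS x hxS hij h').le
        by_contra hc
        exact (hjmax x ((memT x).2 ⟨hxS, hc⟩)).not_gt h'
    · rw [hval]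
      exact mul_pos haa (hlow a ha hai)

end

/-! ### The norm of a regular symmetric body and its norming functionals -/

section

variable {d : ℕ} {C : Set (EuclideanSpace ℝ (Fin d))}

lemma IsRegularSymmetricBody.mem_nhds (hC : IsRegularSymmetricBody C) : C ∈ 𝓝 0 := by
  obtain ⟨x, hx⟩ := hC.interior_nonempty
  have hneg : -x ∈ interior C := by
    refine mem_interior.2 ⟨-interior C, fun y hy => ?_, isOpen_interior.neg, by simpa using hx⟩
    simpa using hC.symmetric _ (interior_subset hy)
  have := hC.convex.interior.midpoint_mem hx hneg
  rw [midpoint_self_neg] at this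
  exact mem_interior_iff_mem_nhds.1 this

lemma IsRegularSymmetricBody.absorbent (hC : IsRegularSymmetricBody C) : Absorbent ℝ C :=
  absorbent_nhds_zero hC.mem_nhds

lemma IsRegularSymmetricBody.gauge_pos (hC : IsRegularSymmetricBody C)
    {x : EuclideanSpace ℝ (Fin d)} : 0 < gauge C x ↔ x ≠ 0 :=
  _root_.gauge_pos hC.absorbent (NormedSpace.isVonNBounded_of_isBounded _ hC.isCompact.isBounded)

lemma IsRegularSymmetricBody.gauge_add_le (hC : IsRegularSymmetricBody C)
    (x y : EuclideanSpace ℝ (Fin d)) : gauge C (x + y) ≤ gauge C x + gauge C y :=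
  _root_.gauge_add_le hC.convex hC.absorbent x y

lemma IsRegularSymmetricBody.gauge_smul (hC : IsRegularSymmetricBody C) (t : ℝ)
    (x : EuclideanSpace ℝ (Fin d)) : gauge C (t • x) = |t| * gauge C x := by
  rcases le_total 0 t with h | h
  · rw [gauge_smul_of_nonneg h, abs_of_nonneg h, smul_eq_mul]
  · rw [← gauge_neg hC.symmetric, ← neg_smul, gauge_smul_of_nonneg (neg_nonneg.2 h),
      abs_of_nonpos h, smul_eq_mul]

lemma IsRegularSymmetricBody.gauge_sub_comm (hC : IsRegularSymmetricBody C)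
    (x y : EuclideanSpace ℝ (Fin d)) : gauge C (x - y) = gauge C (y - x) := by
  rw [← gauge_neg hC.symmetric, neg_sub]

lemma IsRegularSymmetricBody.mem_iff (hC : IsRegularSymmetricBody C)
    {x : EuclideanSpace ℝ (Fin d)} : x ∈ C ↔ gauge C x ≤ 1 := by
  rw [gauge_le_one_iff_mem_closure hC.convex hC.mem_nhds, hC.isCompact.isClosed.closure_eq]

lemma IsRegularSymmetricBody.inv_smul_mem_frontier (hC : IsRegularSymmetricBody C)
    {x : EuclideanSpace ℝ (Fin d)} (hx : x ≠ 0) : (gauge C x)⁻¹ • x ∈ frontier C := by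
  rw [← gauge_eq_one_iff_mem_frontier hC.convex hC.mem_nhds, hC.gauge_smul, abs_inv,
    abs_of_nonneg (gauge_nonneg x), inv_mul_cancel₀ (hC.gauge_pos.2 hx).ne']

/-- `z` has dual norm at most one and attains the norm of `x`. -/
def IsNorming (C : Set (EuclideanSpace ℝ (Fin d))) (x z : EuclideanSpace ℝ (Fin d)) : Prop :=
  ⟪z, x⟫ = gauge C x ∧ ∀ y, ⟪z, y⟫ ≤ gauge C y

lemma IsRegularSymmetricBody.inner_le_gauge (hC : IsRegularSymmetricBody C)
    {z : EuclideanSpace ℝ (Fin d)} {c : ℝ} (h : ∀ y ∈ C, ⟪z, y⟫ ≤ c)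
    (y : EuclideanSpace ℝ (Fin d)) : ⟪z, y⟫ ≤ c * gauge C y := by
  rcases eq_or_ne y 0 with rfl | hy
  · simp [gauge_zero]
  · have hpos := hC.gauge_pos.2 hy
    have := h _ (hC.isCompact.isClosed.frontier_subset (hC.inv_smul_mem_frontier hy))
    rw [inner_smul_right, inv_mul_le_iff₀ hpos] at this
    linarith

lemma IsRegularSymmetricBody.exists_isNorming (hC : IsRegularSymmetricBody C)
    {x : EuclideanSpace ℝ (Fin d)} (hx : x ≠ 0) : ∃ z, IsNorming C x z := by
  have hpos := hC.gauge_pos.2 hx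
  obtain ⟨H, ⟨⟨z, c, hz, rfl, hle, -⟩, hxH⟩, -⟩ := hC.smooth _ (hC.inv_smul_mem_frontier hx)
  change ⟪z, (gauge C x)⁻¹ • x⟫ = c at hxH
  have hin := hC.inner_le_gauge hle
  -- Testing the functional on `z` itself shows that the level `c` is positive, so it can be scaled
  -- to one.
  have hzz := hin z
  rw [real_inner_self_eq_norm_sq] at hzz
  have hc : 0 < c := by
    have h1 : 0 < ‖z‖ ^ 2 := by positivity
    exact pos_of_mul_pos_left (h1.trans_le hzz) (gauge_nonneg z)
  refine ⟨c⁻¹ • z, ?_, fun y => ?_⟩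
  · rw [inner_smul_left, ← hxH, inner_smul_right, RCLike.conj_to_real]
    have : ⟪z, x⟫ ≠ 0 := by
      intro h0
      rw [inner_smul_right, h0, mul_zero] at hxH
      exact hc.ne hxH
    field_simp
  · rw [inner_smul_left, RCLike.conj_to_real, inv_mul_le_iff₀ hc]
    exact hin y

lemma IsNorming.ne_zero (hC : IsRegularSymmetricBody C) {x z : EuclideanSpace ℝ (Fin d)}
    (hx : x ≠ 0) (h : IsNorming C x z) : z ≠ 0 := by
  rintro rfl
  have := h.1
  rw [inner_zero_left] at this
  exact (hC.gauge_pos.2 hx).ne this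

lemma IsNorming.inner_inv_smul (hC : IsRegularSymmetricBody C) {x z : EuclideanSpace ℝ (Fin d)}
    (hx : x ≠ 0) (h : IsNorming C x z) : ⟪z, (gauge C x)⁻¹ • x⟫ = 1 := by
  rw [inner_smul_right, h.1, inv_mul_cancel₀ (hC.gauge_pos.2 hx).ne']

lemma IsNorming.isTangentHyperplane (hC : IsRegularSymmetricBody C)
    {x z : EuclideanSpace ℝ (Fin d)} (hx : x ≠ 0) (h : IsNorming C x z) :
    IsTangentHyperplane C {y | ⟪z, y⟫ = 1} :=
  ⟨z, 1, h.ne_zero hC hx, rfl, fun y hy => (h.2 y).trans (gauge_le_one_of_mem hy),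
    (gauge C x)⁻¹ • x, h.inner_inv_smul hC hx,
    hC.isCompact.isClosed.frontier_subset (hC.inv_smul_mem_frontier hx)⟩

/-- Both functionals cut out the unique tangent hyperplane at the boundary point in direction `x`,
at the same level one. -/
lemma IsNorming.unique (hC : IsRegularSymmetricBody C) {x z z' : EuclideanSpace ℝ (Fin d)}
    (hx : x ≠ 0) (h : IsNorming C x z) (h' : IsNorming C x z') : z = z' := by
  have hH : {y | ⟪z, y⟫ = (1 : ℝ)} = {y | ⟪z', y⟫ = 1} :=
    (hC.smooth _ (hC.inv_smul_mem_frontier hx)).unique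
      ⟨h.isTangentHyperplane hC hx, h.inner_inv_smul hC hx⟩
      ⟨h'.isTangentHyperplane hC hx, h'.inner_inv_smul hC hx⟩
  refine ext_inner_right ℝ fun y => ?_
  set u := (gauge C x)⁻¹ • x
  have hu := h.inner_inv_smul hC hx
  have hu' := h'.inner_inv_smul hC hx
  -- This moves `u` by the part of `y` in the kernel of `z`, staying in the common hyperplane;
  -- evaluating `z'` there gives `⟪z', y⟫ = ⟪z, y⟫`.
  have : u + (y - ⟪z, y⟫ • u) ∈ {y | ⟪z, y⟫ = (1 : ℝ)} := by
    simp only [Set.mem_ofPred_eq, inner_add_right, inner_sub_right, inner_smul_right, u, hu]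
    ring
  rw [hH] at this
  simp only [Set.mem_ofPred_eq, inner_add_right, inner_sub_right, inner_smul_right, u, hu'] at this
  linarith

/-- Strict convexity: a functional attains the norm in one direction only. -/
lemma IsNorming.parallel (hC : IsRegularSymmetricBody C) {x y z : EuclideanSpace ℝ (Fin d)}
    (hx : x ≠ 0) (hy : y ≠ 0) (h : IsNorming C x z) (h' : IsNorming C y z) :
    (gauge C x)⁻¹ • x = (gauge C y)⁻¹ • y := by
  obtain ⟨c, hc⟩ := hC.strictlyConvex _ (h.isTangentHyperplane hC hx)
  have mem : ∀ w, w ≠ 0 → IsNorming C w z → (gauge C w)⁻¹ • w ∈ ({c} : Set _) := fun w hw hn =>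
    hc ▸ ⟨hn.inner_inv_smul hC hw,
      hC.isCompact.isClosed.frontier_subset (hC.inv_smul_mem_frontier hw)⟩
  exact (mem x hx h).trans (mem y hy h').symm

lemma IsRegularSymmetricBody.isSupport_iff (hC : IsRegularSymmetricBody C)
    {x z : EuclideanSpace ℝ (Fin d)} (hx : x ≠ 0) :
    IsSupport C x z ↔ IsNorming C x ((gauge C x)⁻¹ • z) := by
  have hpos := hC.gauge_pos.2 hx
  have hcont : ContinuousOn (fun y => |⟪z, y⟫|) C := by fun_prop
  have hbdd : BddAbove ((fun y => |⟪z, y⟫|) '' C) := hC.isCompact.bddAbove_image hcont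
  have hinner : ∀ y, ⟪(gauge C x)⁻¹ • z, y⟫ = (gauge C x)⁻¹ * ⟪z, y⟫ := fun y => by
    rw [inner_smul_left, RCLike.conj_to_real]
  simp only [IsSupport, IsNorming, bodyNorm, hinner, inv_mul_le_iff₀ hpos,
    inv_mul_eq_iff_eq_mul₀ hpos.ne', ← sq]
  refine and_congr_right fun hzx => ⟨fun hd => hC.inner_le_gauge fun y hy => ?_, fun h => ?_⟩
  · rw [← hd]
    exact (le_abs_self _).trans (le_csSup hbdd ⟨y, hy, rfl⟩)
  · apply le_antisymm
    · refine csSup_le ⟨_, 0, mem_of_mem_nhds hC.mem_nhds, rfl⟩ ?_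
      rintro _ ⟨y, hy, rfl⟩
      have hy1 := gauge_le_one_of_mem hy
      have h1 := h y
      have h2 := h (-y)
      rw [gauge_neg hC.symmetric, inner_neg_right] at h2
      have := mul_le_of_le_one_right hpos.le hy1
      exact abs_le.2 ⟨by linarith, by linarith⟩
    · refine le_csSup hbdd ⟨(gauge C x)⁻¹ • x,
        hC.isCompact.isClosed.frontier_subset (hC.inv_smul_mem_frontier hx), ?_⟩
      simp only
      rw [inner_smul_right, hzx, sq, inv_mul_cancel_left₀ hpos.ne', abs_of_pos hpos]

lemma IsRegularSymmetricBody.isNorming_dualityMap (hC : IsRegularSymmetricBody C)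
    {x : EuclideanSpace ℝ (Fin d)} (hx : x ≠ 0) :
    IsNorming C x ((gauge C x)⁻¹ • dualityMap C x) := by
  have hpos := hC.gauge_pos.2 hx
  have h : ∃! z, IsSupport C x z := by
    obtain ⟨z, hz⟩ := hC.exists_isNorming hx
    refine ⟨gauge C x • z, ?_, fun z' hz' => ?_⟩
    · simp only
      rwa [hC.isSupport_iff hx, inv_smul_smul₀ hpos.ne']
    · replace hz' := (hC.isSupport_iff hx).1 hz'
      rw [← hz'.unique hC hx hz, smul_inv_smul₀ hpos.ne']
  rw [← hC.isSupport_iff hx, dualityMap, dif_pos h]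
  exact h.choose_spec.1

lemma IsRegularSymmetricBody.isCompact_dualBall (hC : IsRegularSymmetricBody C) :
    IsCompact {z : EuclideanSpace ℝ (Fin d) | ∀ y, ⟪z, y⟫ ≤ gauge C y} := by
  obtain ⟨r, hr, hball⟩ := Metric.mem_nhds_iff.1 hC.mem_nhds
  refine Metric.isCompact_of_isClosed_isBounded ?_ ?_
  · have : {z : EuclideanSpace ℝ (Fin d) | ∀ y, ⟪z, y⟫ ≤ gauge C y}
        = ⋂ y, {z | ⟪z, y⟫ ≤ gauge C y} := by ext; simp
    rw [this]
    exact isClosed_iInter fun y => isClosed_le (by fun_prop) continuous_const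
  · refine (Metric.isBounded_closedBall (x := 0) (r := r⁻¹)).subset fun z hz => ?_
    rw [mem_closedBall_zero_iff]
    have h1 := hz z
    rw [real_inner_self_eq_norm_sq] at h1
    have h2 : r * gauge C z ≤ ‖z‖ := mul_gauge_le_norm hball
    rcases (norm_nonneg z).eq_or_lt with h0 | h0
    · rw [← h0]; positivity
    · rw [← one_div, le_div_iff₀ hr]
      nlinarith

/-- The norming functional depends continuously on the direction. -/
lemma IsRegularSymmetricBody.tendsto_norming (hC : IsRegularSymmetricBody C)
    {u : EuclideanSpace ℝ (Fin d) → EuclideanSpace ℝ (Fin d)}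
    (hu : ∀ y, y ≠ 0 → IsNorming C y (u y)) {x : EuclideanSpace ℝ (Fin d)} (hx : x ≠ 0) :
    Tendsto u (𝓝 x) (𝓝 (u x)) := by
  have hne : ∀ᶠ y in 𝓝 x, y ≠ 0 := isOpen_ne.mem_nhds hx
  -- By compactness it suffices that every cluster point `z` is `u x`; such a `z` norms `x`, so
  -- uniqueness applies.
  refine hC.isCompact_dualBall.tendsto_nhds_of_unique_mapClusterPt
    (hne.mono fun y hy => (hu y hy).2) fun z hz hcl => ?_
  refine IsNorming.unique hC hx ⟨?_, hz⟩ (hu x hx)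
  have hg := continuous_gauge hC.convex hC.mem_nhds
  have hlim : Tendsto (fun y => ⟪u y, x⟫) (𝓝 x) (𝓝 (gauge C x)) := by
    have hlow : Tendsto (fun y => gauge C y - gauge C (y - x)) (𝓝 x) (𝓝 (gauge C x)) := by
      have : Continuous fun y => gauge C y - gauge C (y - x) :=
        hg.sub (hg.comp (continuous_id.sub continuous_const))
      simpa [gauge_zero] using this.tendsto x
    refine tendsto_of_tendsto_of_tendsto_of_le_of_le' hlow tendsto_const_nhds ?_ ?_
    · filter_upwards [hne] with y hy
      have h1 := (hu y hy).1
      have h2 := (hu y hy).2 (y - x)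
      rw [inner_sub_right] at h2
      linarith
    · filter_upwards [hne] with y hy using (hu y hy).2 x
  have hcont : Tendsto (fun w => ⟪w, x⟫) (𝓝 z) (𝓝 ⟪z, x⟫) :=
    Continuous.tendsto (by fun_prop) z
  have hmc : MapClusterPt ⟪z, x⟫ (𝓝 x) (fun y => ⟪u y, x⟫) :=
    hcl.tendsto_comp (f := fun w => ⟪w, x⟫) hcont
  have hnb : (𝓝 ⟪z, x⟫ ⊓ 𝓝 (gauge C x)).NeBot :=
    hmc.clusterPt.neBot.mono (inf_le_inf_left _ hlim)
  exact eq_of_nhds_neBot hnb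

/-- The norm of a smooth body is differentiable away from the origin. -/
lemma IsRegularSymmetricBody.differentiableAt_gauge (hC : IsRegularSymmetricBody C)
    {x : EuclideanSpace ℝ (Fin d)} (hx : x ≠ 0) : DifferentiableAt ℝ (gauge C) x := by
  set u : EuclideanSpace ℝ (Fin d) → EuclideanSpace ℝ (Fin d) :=
    fun y => (gauge C y)⁻¹ • dualityMap C y
  have hu : ∀ y, y ≠ 0 → IsNorming C y (u y) := fun y hy => hC.isNorming_dualityMap hy
  have hadd : Tendsto (fun h => x + h) (𝓝 0) (𝓝 x) := by
    simpa using (continuous_const_add x).tendsto (0 : EuclideanSpace ℝ (Fin d))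
  have hlim : Tendsto (fun h => ‖u (x + h) - u x‖) (𝓝 0) (𝓝 0) := by
    simpa using (((hC.tendsto_norming hu hx).comp hadd).sub_const (u x)).norm
  have hne : ∀ᶠ h in 𝓝 (0 : EuclideanSpace ℝ (Fin d)), x + h ≠ 0 :=
    hadd.eventually (isOpen_ne.mem_nhds hx)
  -- The subgradient inequalities at `x` and `x + h` place the remainder between `0` and `⟪u (x + h)
  -- - u x, h⟫`.
  have : HasFDerivAt (gauge C) (innerSL ℝ (u x)) x := by
    rw [hasFDerivAt_iff_isLittleO_nhds_zero, Asymptotics.isLittleO_iff]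
    intro c hc
    filter_upwards [hne, hlim.eventually (gt_mem_nhds hc)] with h hh hlt
    have e1 := (hu x hx).1
    have e2 := (hu x hx).2 (x + h)
    have e3 := (hu (x + h) hh).1
    have e4 := (hu (x + h) hh).2 x
    rw [inner_add_right] at e2 e3
    have e5 : ⟪u (x + h) - u x, h⟫ ≤ ‖u (x + h) - u x‖ * ‖h‖ := real_inner_le_norm _ _
    rw [inner_sub_left] at e5
    have e6 : ‖u (x + h) - u x‖ * ‖h‖ ≤ c * ‖h‖ := by gcongr
    rw [innerSL_apply_apply, Real.norm_eq_abs, abs_of_nonneg (by linarith)]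
    linarith
  exact this.differentiableAt

end

/-! ### Packings: distances between centres and planarity -/

section

variable {V : Type*}

section Packing

variable {d : ℕ} {C : Set (EuclideanSpace ℝ (Fin d))} {G : SimpleGraph V}
  {p : V → EuclideanSpace ℝ (Fin d)} {r : V → ℝ}

lemma IsRegularSymmetricBody.mem_interior_homotheticCopy (hC : IsRegularSymmetricBody C) {v : V}
    (hr : 0 < r v) {z : EuclideanSpace ℝ (Fin d)} (hz : gauge C (z - p v) < r v) :
    z ∈ interior (homotheticCopy C p r v) := by
  have hcont : Continuous fun z => gauge C (z - p v) :=
    (continuous_gauge hC.convex hC.mem_nhds).comp (continuous_id.sub continuous_const)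
  refine mem_interior.2 ⟨{z | gauge C (z - p v) < r v}, fun y hy => ?_,
    isOpen_lt hcont continuous_const, hz⟩
  refine ⟨(r v)⁻¹ • (y - p v), ?_, ?_⟩
  · rw [hC.mem_iff, hC.gauge_smul, abs_of_pos (inv_pos.2 hr), inv_mul_le_iff₀ hr, mul_one]
    exact le_of_lt hy
  · simp only [smul_inv_smul₀ hr.ne', sub_add_cancel]

/-- If the centres were closer, the point dividing their segment in the ratio of the radii would be
interior to both copies. -/
lemma IsPacking.add_le_gauge (hC : IsRegularSymmetricBody C) (hP : IsPacking C G p r) {v w : V}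
    (hvw : v ≠ w) : r v + r w ≤ gauge C (p v - p w) := by
  by_contra hlt
  push Not at hlt
  have hv := hP.radius_pos v
  have hw := hP.radius_pos w
  have hs : 0 < r v + r w := by linarith
  set z := p v + (r v / (r v + r w)) • (p w - p v) with hz
  have e1 : z - p v = (r v / (r v + r w)) • (p w - p v) := by rw [hz]; abel
  have e2 : z - p w = (r w / (r v + r w)) • (p v - p w) := by
    have : r w / (r v + r w) = 1 - r v / (r v + r w) := by field_simp; ring
    rw [hz, this]; module
  refine Set.disjoint_left.1 (hP.disjoint_interior v w hvw)
    (hC.mem_interior_homotheticCopy (z := z) hv ?_) (hC.mem_interior_homotheticCopy hw ?_)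
  · rw [e1, hC.gauge_smul, abs_of_pos (by positivity), hC.gauge_sub_comm, div_mul_eq_mul_div,
      div_lt_iff₀ hs]
    exact mul_lt_mul_of_pos_left hlt hv
  · rw [e2, hC.gauge_smul, abs_of_pos (by positivity), div_mul_eq_mul_div, div_lt_iff₀ hs]
    exact mul_lt_mul_of_pos_left hlt hw

lemma IsPacking.gauge_eq (hC : IsRegularSymmetricBody C) (hP : IsPacking C G p r) {v w : V}
    (h : G.Adj v w) : gauge C (p v - p w) = r v + r w := by
  refine le_antisymm ?_ (hP.add_le_gauge hC h.ne)
  obtain ⟨-, z, ⟨x, hx, rfl⟩, y, hy, hxy⟩ := (hP.adj_iff v w).1 h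
  have e : p v - p w = r w • y + r v • (-x) := by
    simp only at hxy
    rw [smul_neg, ← sub_eq_add_neg, sub_eq_sub_iff_add_eq_add, hxy, add_comm]
  rw [e]
  refine (hC.gauge_add_le _ _).trans ?_
  rw [hC.gauge_smul, hC.gauge_smul, gauge_neg hC.symmetric, abs_of_pos (hP.radius_pos v),
    abs_of_pos (hP.radius_pos w)]
  have h1 := mul_le_of_le_one_right (hP.radius_pos v).le (gauge_le_one_of_mem hx)
  have h2 := mul_le_of_le_one_right (hP.radius_pos w).le (gauge_le_one_of_mem hy)
  linarith

lemma IsPacking.sub_ne_zero (hC : IsRegularSymmetricBody C) (hP : IsPacking C G p r) {v w : V}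
    (hvw : v ≠ w) : p v - p w ≠ 0 := by
  rw [← hC.gauge_pos]
  exact (add_pos (hP.radius_pos v) (hP.radius_pos w)).trans_le (hP.add_le_gauge hC hvw)

lemma IsPacking.injective (hC : IsRegularSymmetricBody C) (hP : IsPacking C G p r) :
    Function.Injective p := by
  intro v w h
  by_contra hne
  exact hP.sub_ne_zero hC hne (sub_eq_zero.2 h)

/-- Two edges at a vertex have different directions. -/
lemma IsPacking.direction_ne (hC : IsRegularSymmetricBody C) (hP : IsPacking C G p r) {v w x : V}
    (hw : G.Adj v w) (hx : G.Adj v x) (hwx : w ≠ x) :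
    (gauge C (p v - p w))⁻¹ • (p v - p w) ≠ (gauge C (p v - p x))⁻¹ • (p v - p x) := by
  intro h
  have pw := hC.gauge_pos.2 (hP.sub_ne_zero hC hw.ne)
  have px := hC.gauge_pos.2 (hP.sub_ne_zero hC hx.ne)
  set e := (gauge C (p v - p w))⁻¹ • (p v - p w) with he
  have e1 : p v - p w = gauge C (p v - p w) • e := by rw [he, smul_inv_smul₀ pw.ne']
  have e2 : p v - p x = gauge C (p v - p x) • e := by rw [h, smul_inv_smul₀ px.ne']
  have ge : gauge C e = 1 := by
    rw [he, hC.gauge_smul, abs_of_pos (inv_pos.2 pw), inv_mul_cancel₀ pw.ne']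
  -- Two touching neighbours in the same direction would have centres at distance `|r x - r w|`, too
  -- close for disjoint interiors.
  have e3 : p w - p x = (gauge C (p v - p x) - gauge C (p v - p w)) • e := by
    rw [sub_smul, ← e1, ← e2]; abel
  have h1 := hP.add_le_gauge hC hwx
  rw [e3, hC.gauge_smul, ge, mul_one, hP.gauge_eq hC hw, hP.gauge_eq hC hx] at h1
  have h2 := hP.radius_pos w
  have h3 := hP.radius_pos x
  have : |r v + r x - (r v + r w)| < r w + r x := abs_lt.2 ⟨by linarith, by linarith⟩
  linarith

lemma IsRegularSymmetricBody.inv_gauge_smul_smul (hC : IsRegularSymmetricBody C) {t : ℝ}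
    (ht : 0 < t) (x : EuclideanSpace ℝ (Fin d)) :
    (gauge C (t • x))⁻¹ • (t • x) = (gauge C x)⁻¹ • x := by
  rw [hC.gauge_smul, abs_of_pos ht, smul_smul]
  congr 1
  field_simp

/-- Equality in the triangle inequality of a strictly convex norm. -/
lemma IsRegularSymmetricBody.eq_smul_of_gauge_add_eq (hC : IsRegularSymmetricBody C)
    {x y : EuclideanSpace ℝ (Fin d)} (hx : x ≠ 0) (hy : y ≠ 0)
    (h : gauge C (x + y) = gauge C x + gauge C y) : ∃ t : ℝ, 0 < t ∧ y = t • x := by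
  have px := hC.gauge_pos.2 hx
  have py := hC.gauge_pos.2 hy
  have hxy : x + y ≠ 0 := hC.gauge_pos.1 (by rw [h]; positivity)
  obtain ⟨z, hz1, hz2⟩ := hC.exists_isNorming hxy
  rw [inner_add_right, h] at hz1
  have h1 := hz2 x
  have h2 := hz2 y
  have := IsNorming.parallel hC hx hy (z := z) ⟨by linarith, hz2⟩ ⟨by linarith, hz2⟩
  refine ⟨gauge C y / gauge C x, by positivity, ?_⟩
  rw [div_eq_mul_inv, mul_smul, this, smul_inv_smul₀ py.ne']

lemma IsRegularSymmetricBody.gauge_of_mem_openSegment (hC : IsRegularSymmetricBody C)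
    {x y z : EuclideanSpace ℝ (Fin d)} (hxy : x ≠ y) (hz : z ∈ openSegment ℝ x y) :
    z - x ≠ 0 ∧ z - y ≠ 0 ∧ gauge C (z - x) + gauge C (z - y) = gauge C (x - y) ∧
      (∃ t : ℝ, 0 < t ∧ z - x = t • (y - x)) ∧ ∃ t : ℝ, 0 < t ∧ z - y = (-t) • (z - x) := by
  obtain ⟨s, t, hs, ht, hst, rfl⟩ := hz
  have e1 : s • x + t • y - x = t • (y - x) := by
    obtain rfl : s = 1 - t := by linarith
    module
  have e2 : s • x + t • y - y = s • (x - y) := by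
    obtain rfl : t = 1 - s := by linarith
    module
  refine ⟨?_, ?_, ?_, ⟨t, ht, e1⟩, s / t, by positivity, ?_⟩
  · rw [e1]; exact smul_ne_zero ht.ne' (sub_ne_zero.2 hxy.symm)
  · rw [e2]; exact smul_ne_zero hs.ne' (sub_ne_zero.2 hxy)
  · rw [e1, e2, hC.gauge_smul, hC.gauge_smul, hC.gauge_sub_comm y x, abs_of_pos ht,
      abs_of_pos hs, ← add_mul, add_comm t s, hst, one_mul]
  · rw [e1, e2, smul_smul, neg_mul, div_mul_cancel₀ _ ht.ne', neg_smul, ← smul_neg, neg_sub]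

lemma IsPacking.disjoint_openSegment_of_adj (hC : IsRegularSymmetricBody C)
    (hP : IsPacking C G p r) {v w x : V} (hw : G.Adj v w) (hx : G.Adj v x) (hwx : w ≠ x) :
    Disjoint (openSegment ℝ (p v) (p w)) (openSegment ℝ (p v) (p x)) := by
  have hinj := hP.injective hC
  rw [Set.disjoint_left]
  intro z hz hz'
  obtain ⟨-, -, -, ⟨s, hs, h1⟩, -⟩ := hC.gauge_of_mem_openSegment (hinj.ne hw.ne) hz
  obtain ⟨-, -, -, ⟨t, ht, h2⟩, -⟩ := hC.gauge_of_mem_openSegment (hinj.ne hx.ne) hz'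
  apply hP.direction_ne hC hw hx hwx
  have h3 : s • (p v - p w) = t • (p v - p x) := by
    rw [← neg_sub (p w), ← neg_sub (p x), smul_neg, smul_neg, ← h1, ← h2]
  rw [← hC.inv_gauge_smul_smul hs (p v - p w), ← hC.inv_gauge_smul_smul ht (p v - p x), h3]

/-- At a crossing point the triangle inequalities for pairs of ends of different edges must all be
equalities. By strict convexity the point would then lie between `p x` and each of `p v`, `p w`,
though it also separates `p v` from `p w`. -/
lemma IsPacking.disjoint_openSegment_of_ne (hC : IsRegularSymmetricBody C)
    (hP : IsPacking C G p r) {v w x y : V} (hvw : G.Adj v w) (hxy : G.Adj x y)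
    (hvx : v ≠ x) (hvy : v ≠ y) (hwx : w ≠ x) (hwy : w ≠ y) :
    Disjoint (openSegment ℝ (p v) (p w)) (openSegment ℝ (p x) (p y)) := by
  have hinj := hP.injective hC
  rw [Set.disjoint_left]
  intro z hz hz'
  obtain ⟨nv, nw, s1, -, c1, hc1, h1⟩ := hC.gauge_of_mem_openSegment (hinj.ne hvw.ne) hz
  obtain ⟨nx, ny, s2, -, -⟩ := hC.gauge_of_mem_openSegment (hinj.ne hxy.ne) hz'
  rw [hP.gauge_eq hC hvw] at s1
  rw [hP.gauge_eq hC hxy] at s2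
  have tri : ∀ a b, gauge C (p a - p b) ≤ gauge C (z - p a) + gauge C (z - p b) := by
    intro a b
    have := hC.gauge_add_le (p a - z) (z - p b)
    rwa [sub_add_sub_cancel, hC.gauge_sub_comm (p a) z] at this
  have l1 := hP.add_le_gauge hC hvx
  have l2 := hP.add_le_gauge hC hvy
  have l3 := hP.add_le_gauge hC hwx
  have l4 := hP.add_le_gauge hC hwy
  have t1 := tri v x
  have t2 := tri v y
  have t3 := tri w x
  have t4 := tri w y
  have eq : ∀ a b, z - p a ≠ 0 → z - p b ≠ 0 →
      gauge C (p a - p b) = gauge C (z - p a) + gauge C (z - p b) →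
      ∃ t : ℝ, 0 < t ∧ z - p b = (-t) • (z - p a) := by
    intro a b ha hb h
    obtain ⟨t, ht, e⟩ := hC.eq_smul_of_gauge_add_eq (x := p a - z) (y := z - p b)
      (by rwa [← neg_sub, neg_ne_zero]) hb
      (by rw [sub_add_sub_cancel, h, hC.gauge_sub_comm (p a) z])
    exact ⟨t, ht, by rw [e, neg_smul, ← smul_neg, neg_sub]⟩
  obtain ⟨c2, hc2, h2⟩ := eq v x nv nx (by linarith)
  obtain ⟨c3, hc3, h3⟩ := eq w x nw nx (by linarith)
  rw [h2, h1, smul_smul] at h3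
  have h4 := smul_left_injective ℝ nv h3
  nlinarith [mul_pos hc3 hc1]

lemma IsPacking.notMem_openSegment (hC : IsRegularSymmetricBody C)
    (hP : IsPacking C G p r) {v w : V} (hvw : G.Adj v w) (x : V) :
    p x ∉ openSegment ℝ (p v) (p w) := by
  intro hz
  obtain ⟨nv, nw, s1, -⟩ := hC.gauge_of_mem_openSegment ((hP.injective hC).ne hvw.ne) hz
  have h1 := hP.add_le_gauge hC (v := x) (w := v) fun e => nv (by rw [e, sub_self])
  have h2 := hP.add_le_gauge hC (v := x) (w := w) fun e => nw (by rw [e, sub_self])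
  rw [hP.gauge_eq hC hvw] at s1
  have := hP.radius_pos x
  linarith

lemma IsPacking.wellPositioned [Fintype V] [DecidableEq V] [DecidableRel G.Adj]
    (hC : IsRegularSymmetricBody C) (hP : IsPacking C G p r) : WellPositioned C G p := by
  have hne : ∀ e : G.edgeSet, p (Quot.out e.1).1 - p (Quot.out e.1).2 ≠ 0 := by
    intro e
    have h : s((Quot.out e.1).1, (Quot.out e.1).2) = e.1 := Quot.out_eq e.1
    have hadj : G.Adj (Quot.out e.1).1 (Quot.out e.1).2 := by
      rw [← SimpleGraph.mem_edgeSet, h]; exact e.2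
    exact hP.sub_ne_zero hC hadj.ne
  refine ⟨fun e => ?_, differentiableAt_pi.2 fun e => ?_⟩
  · have := hC.gauge_pos.2 (hne e)
    simp only [rigidityMap, bodyNorm]
    positivity
  · have h1 : DifferentiableAt ℝ (fun q : V → EuclideanSpace ℝ (Fin d) =>
        q (Quot.out e.1).1 - q (Quot.out e.1).2) p := by fun_prop
    have h2 := (hC.differentiableAt_gauge (hne e)).comp p h1
    exact (h2.pow 2).const_mul (1 / 2)

end Packing

/-! ### Vanishing of the stress in the plane -/

section Plane

variable {C : Set (EuclideanSpace ℝ (Fin 2))} {G : SimpleGraph V}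
  {p : V → EuclideanSpace ℝ (Fin 2)} {r : V → ℝ}

/-- The contact graph of a packing is drawn without crossings. -/
lemma IsPacking.isPlaneDrawing (hC : IsRegularSymmetricBody C) (hP : IsPacking C G p r) :
    IsPlaneDrawing p G := by
  refine ⟨fun v w x h => hP.notMem_openSegment hC h x, fun v w x y hvw hxy hne => ?_⟩
  by_cases hvx : v = x
  · subst hvx
    exact hP.disjoint_openSegment_of_adj hC hvw hxy fun e => hne (by rw [e])
  by_cases hvy : v = y
  · subst hvy
    rw [openSegment_symm ℝ (p x)]
    exact hP.disjoint_openSegment_of_adj hC hvw hxy.symm fun e => hne (by rw [e, Sym2.eq_swap])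
  by_cases hwx : w = x
  · subst hwx
    rw [openSegment_symm ℝ (p v)]
    exact hP.disjoint_openSegment_of_adj hC hvw.symm hxy hvy
  by_cases hwy : w = y
  · subst hwy
    rw [openSegment_symm ℝ (p v), openSegment_symm ℝ (p x)]
    exact hP.disjoint_openSegment_of_adj hC hvw.symm hxy.symm hvx
  exact hP.disjoint_openSegment_of_ne hC hvw hxy hvx hvy hwx hwy

/-- A packing has no non-zero equilibrium stress that also balances the edge lengths. -/
theorem IsPacking.eq_zero_of_equilibrium [Fintype V] (hC : IsRegularSymmetricBody C)
    (hP : IsPacking C G p r) {b : V → V → ℝ} (hsymm : ∀ v w, b v w = b w v)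
    (hadj : ∀ v w, b v w ≠ 0 → G.Adj v w)
    (h1 : ∀ v, ∑ w, b v w • dualityMap C (p v - p w) = 0)
    (h2 : ∀ v, ∑ w, b v w * gauge C (p v - p w) = 0) (v w : V) : b v w = 0 := by
  classical
  by_contra hvw
  have hinj := hP.injective hC
  obtain ⟨ε, hε⟩ := exists_generic_height hinj
  -- Only vertices carrying stress are kept, so that the dependence at each of them is nontrivial.
  let W := {x : V // ∃ y, b x y ≠ 0}
  let F : SimpleGraph W :=
    { Adj := fun x y => b x y ≠ 0
      symm := ⟨fun x y h => by rwa [hsymm]⟩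
      loopless := ⟨fun x h => (hadj _ _ h).ne rfl⟩ }
  have : Nonempty W := ⟨⟨v, w, hvw⟩⟩
  have hF : IsPlaneDrawing (fun x : W => p x) F := by
    refine ⟨fun x y z h => (hP.isPlaneDrawing hC).vertex _ _ _ (hadj _ _ h),
      fun x y z t h h' hne => (hP.isPlaneDrawing hC).edge _ _ _ _ (hadj _ _ h) (hadj _ _ h') ?_⟩
    intro e
    apply hne
    rcases Sym2.eq_iff.1 e with ⟨e1, e2⟩ | ⟨e1, e2⟩
    · rw [Subtype.ext e1, Subtype.ext e2]
    · rw [Subtype.ext e1, Subtype.ext e2, Sym2.eq_swap]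
  obtain ⟨x, hx⟩ := exists_not_alternating (hinj.comp Subtype.val_injective) hF
    (s := fun x y : W => 0 < b x y * gauge C (p x - p y))
    (fun x y => by rw [hsymm, hC.gauge_sub_comm]) (ε := ε)
    (fun x y h => hε _ _ fun e => h (Subtype.ext e))
  set S := Finset.univ.filter fun y => b x y ≠ 0 with hS
  have memS : ∀ y, y ∈ S ↔ b x y ≠ 0 := by simp [hS]
  have hne : ∀ y ∈ S, p x - p y ≠ 0 := fun y hy =>
    hP.sub_ne_zero hC (hadj _ _ ((memS y).1 hy)).ne
  set Z : V → EuclideanSpace ℝ (Fin 2) :=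
    fun y => (gauge C (p x - p y))⁻¹ • dualityMap C (p x - p y) with hZ
  have hnorm : ∀ y ∈ S, IsNorming C (p x - p y) (Z y) := fun y hy =>
    hC.isNorming_dualityMap (hne y hy)
  have hmono : ∀ i ∈ S, ∀ j ∈ S, i ≠ j → ⟪Z j, p x - p i⟫ < ⟪Z i, p x - p i⟫ := by
    intro i hi j hj hij
    rw [(hnorm i hi).1]
    refine lt_of_le_of_ne ((hnorm j hj).2 _) fun e => ?_
    exact hP.direction_ne hC (hadj _ _ ((memS i).1 hi)) (hadj _ _ ((memS j).1 hj)) hij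
      (IsNorming.parallel hC (hne i hi) (hne j hj) ⟨e, (hnorm j hj).2⟩ (hnorm j hj))
  have hsub : ∀ f : V → ℝ, (∀ y, b x y = 0 → f y = 0) → ∑ y ∈ S, f y = ∑ y, f y := by
    intro f hf
    refine Finset.sum_subset (Finset.subset_univ _) fun y _ hy => hf y ?_
    by_contra h
    exact hy ((memS y).2 h)
  suffices h : ∃ u, Alternating (fun y => angleKey ε (p y - p x)) S
      (fun y => 0 < b x y * gauge C (p x - p y)) u by
    obtain ⟨u, hu⟩ := h
    have hmem : ∀ i, b x (u i) ≠ 0 := fun i => (memS _).1 (hu.1 i)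
    refine hx (fun i => ⟨u i, x, by rw [hsymm]; exact hmem i⟩) ⟨fun i => ?_, hu.2⟩
    simpa [F] using hmem i
  -- The coefficients are stress times length: `h2` says that they sum to zero, and `h1` is the
  -- vector relation, the length cancelling the normalisation in `Z`.
  refine exists_alternating _ S ?_ ?_ (Z := Z) (U := fun y => p x - p y) ?_ ?_ ?_ hmono ?_
  · refine (angleKey_injOn (hP.isPlaneDrawing hC) hε x).mono fun y hy => ?_
    exact hadj _ _ ((memS y).1 hy)
  · obtain ⟨y, hy⟩ := x.2
    exact ⟨y, (memS y).2 hy⟩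
  · exact fun y hy => mul_ne_zero ((memS y).1 hy) (hC.gauge_pos.2 (hne y hy)).ne'
  · rw [hsub _ fun y hy => by rw [hy, zero_mul]]
    exact h2 x
  · rw [← h1 x]
    refine Finset.sum_subset_zero_on_sdiff (Finset.subset_univ _) ?_ ?_
    · intro y hy
      have : b x y = 0 := by
        by_contra h
        exact (Finset.mem_sdiff.1 hy).2 ((memS y).2 h)
      rw [this, zero_smul]
    · intro y hy
      simp only [hZ]
      rw [mul_smul, smul_inv_smul₀ (hC.gauge_pos.2 (hne y hy)).ne']
  · intro i hi j hj l hl hij hjl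
    have nij : i ≠ j := by rintro rfl; exact hij.ne rfl
    have njl : j ≠ l := by rintro rfl; exact hjl.ne rfl
    have nil : i ≠ l := by rintro rfl; exact (hij.trans hjl).ne rfl
    have hh : ∀ y ∈ S, height ε (p y - p x) ≠ 0 := fun y hy =>
      hε _ _ (hadj _ _ ((memS y).1 hy)).ne
    refine cross_pos_of_angleKey_lt (hh i hi) (hh j hj) (hh l hl) hij hjl ?_ ?_ ?_ ?_ ?_ ?_ <;>
      rw [neg_sub]
    · exact hmono i hi j hj nij
    · exact hmono i hi l hl nil
    · exact hmono j hj i hi nij.symm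
    · exact hmono j hj l hl njl
    · exact hmono l hl i hi nil.symm
    · exact hmono l hl j hj njl.symm

end Plane

end

/-! ### Edge functions, equilibrium and the rank of the matrix -/

section

variable {V : Type*} {G : SimpleGraph V}

open Classical in
/-- The extension by zero of a function on the edges to all pairs of vertices. -/
noncomputable def edgeWeight (a : G.edgeSet → ℝ) (v w : V) : ℝ :=
  if h : G.Adj v w then a ⟨s(v, w), h⟩ else 0

lemma edgeWeight_of_adj (a : G.edgeSet → ℝ) {v w : V} (h : G.Adj v w) :
    edgeWeight a v w = a ⟨s(v, w), h⟩ := dif_pos h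

lemma edgeWeight_of_not_adj (a : G.edgeSet → ℝ) {v w : V} (h : ¬ G.Adj v w) :
    edgeWeight a v w = 0 := dif_neg h

lemma adj_of_edgeWeight_ne_zero (a : G.edgeSet → ℝ) {v w : V} (h : edgeWeight a v w ≠ 0) :
    G.Adj v w := by
  by_contra hc
  exact h (edgeWeight_of_not_adj a hc)

lemma edgeWeight_comm (a : G.edgeSet → ℝ) (v w : V) : edgeWeight a v w = edgeWeight a w v := by
  by_cases h : G.Adj v w
  · rw [edgeWeight_of_adj a h, edgeWeight_of_adj a h.symm]
    congr 2
    exact Sym2.eq_swap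
  · rw [edgeWeight_of_not_adj a h, edgeWeight_of_not_adj a fun hc => h hc.symm]

lemma eq_zero_of_edgeWeight_eq_zero {a : G.edgeSet → ℝ} (h : ∀ v w, edgeWeight a v w = 0)
    (e : G.edgeSet) : a e = 0 := by
  obtain ⟨e, he⟩ := e
  induction e using Sym2.ind with
  | h v w => rw [← edgeWeight_of_adj a he, h]

lemma sum_neighborSet [Fintype V] {M : Type*} [AddCommMonoid M] (v : V)
    [Fintype (G.neighborSet v)] {g : V → M} (hg : ∀ w, ¬ G.Adj v w → g w = 0) :
    ∑ w : G.neighborSet v, g w.1 = ∑ w, g w := by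
  classical
  rw [← Finset.sum_subtype (Finset.univ.filter (G.Adj v)) (p := (· ∈ G.neighborSet v)) (by simp) g]
  refine Finset.sum_subset (Finset.subset_univ _) fun w _ hw => hg w ?_
  simpa using hw

-- Turns a column of a row relation, a sum over edges at `v`, into the sum over vertices used in the
-- equilibrium conditions.
open Classical in
lemma sum_incident_edges [Fintype V] [Fintype G.edgeSet] (a : G.edgeSet → ℝ) (v : V) (f : V → ℝ) :
    ∑ e : G.edgeSet, a e * (if h : v ∈ e.1 then f (Sym2.Mem.other h) else 0)
      = ∑ w, edgeWeight a v w * f w := by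
  have h1 : ∀ w, edgeWeight a v w = ∑ e : G.edgeSet, if s(v, w) = e.1 then a e else 0 := by
    intro w
    by_cases h : G.Adj v w
    · rw [edgeWeight_of_adj a h, Finset.sum_eq_single ⟨s(v, w), h⟩]
      · simp
      · intro e _ he
        rw [if_neg fun hc => he (Subtype.ext hc.symm)]
      · simp
    · rw [edgeWeight_of_not_adj a h, Finset.sum_eq_zero]
      intro e _
      rw [if_neg]
      intro hc
      have := e.2
      rw [← hc] at this
      exact h this
  have h2 : ∀ e : G.edgeSet, (if h : v ∈ e.1 then f (Sym2.Mem.other h) else 0)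
      = ∑ w, if s(v, w) = e.1 then f w else 0 := by
    intro e
    split_ifs with h
    · have : ∀ w, s(v, w) = e.1 ↔ w = Sym2.Mem.other h := fun w => by
        conv_lhs => rw [← Sym2.other_spec h]
        exact Sym2.congr_right
      simp [this]
    · rw [Finset.sum_eq_zero]
      intro w _
      rw [if_neg]
      intro hc
      exact h (hc ▸ Sym2.mem_mk_left v w)
  simp only [h1, h2, Finset.sum_mul, Finset.mul_sum]
  rw [Finset.sum_comm]
  refine Finset.sum_congr rfl fun w _ => Finset.sum_congr rfl fun e _ => ?_
  split_ifs <;> simp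

variable {C : Set (EuclideanSpace ℝ (Fin 2))} {p : V → EuclideanSpace ℝ (Fin 2)} {r : V → ℝ}

theorem IsPacking.not_isEdgeLengthEquilibriumStress [Fintype V] [DecidableRel G.Adj]
    (hC : IsRegularSymmetricBody C) (hP : IsPacking C G p r) (a : G.edgeSet → ℝ) :
    ¬ IsEdgeLengthEquilibriumStress C G p a := by
  rintro ⟨⟨e, he⟩, h⟩
  refine he (eq_zero_of_edgeWeight_eq_zero (hP.eq_zero_of_equilibrium hC (edgeWeight_comm a)
    (fun _ _ => adj_of_edgeWeight_ne_zero a) (fun v => ?_) fun v => ?_) e)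
  · rw [← sum_neighborSet v fun w hw => by rw [edgeWeight_of_not_adj a hw, zero_smul],
      ← (h v).1]
    exact Finset.sum_congr rfl fun w _ => by rw [edgeWeight_of_adj a w.2]
  · rw [← sum_neighborSet v fun w hw => by rw [edgeWeight_of_not_adj a hw, zero_mul],
      ← (h v).2]
    exact Finset.sum_congr rfl fun w _ => by rw [edgeWeight_of_adj a w.2]; rfl

/-- The point columns of a row relation give the vector equilibrium. The radius columns give the
length equilibrium, since touching centres are at distance `r v + r w`. -/
theorem IsPacking.linearIndependent_row [Fintype V] [Fintype G.edgeSet]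
    (hC : IsRegularSymmetricBody C) (hP : IsPacking C G p r) :
    LinearIndependent ℝ (packingRigidityMatrix C G p r).row := by
  rw [Fintype.linearIndependent_iff]
  intro a ha
  have hcol : ∀ col, ∑ e, a e * packingRigidityMatrix C G p r e col = 0 := fun col => by
    simpa using congrFun ha col
  refine eq_zero_of_edgeWeight_eq_zero (hP.eq_zero_of_equilibrium hC (edgeWeight_comm a)
    (fun _ _ => adj_of_edgeWeight_ne_zero a) (fun v => ?_) fun v => ?_)
  · ext i
    have := (sum_incident_edges a v fun w => dualityMap C (p v - p w) i).symm.trans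
      (hcol (Sum.inl (v, i)))
    simpa using this
  · have := (sum_incident_edges a v fun w => -(r v + r w)).symm.trans (hcol (Sum.inr v))
    simp only [mul_neg, Finset.sum_neg_distrib, neg_eq_zero] at this
    rw [← this]
    refine Finset.sum_congr rfl fun w _ => ?_
    by_cases h : G.Adj v w
    · rw [hP.gauge_eq hC h]
    · rw [edgeWeight_of_not_adj a h, zero_mul, zero_mul]

end

end SymPacking

theorem lemma3p2 {V : Type*} [Fintype V] [DecidableEq V]
    (C : Set (EuclideanSpace ℝ (Fin 2))) (hC : SymPacking.IsRegularSymmetricBody C)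
    (G : SimpleGraph V) [DecidableRel G.Adj]
    (p : V → EuclideanSpace ℝ (Fin 2)) (r : V → ℝ) (hP : SymPacking.IsPacking C G p r) :
    SymPacking.WellPositioned C G p ∧
    (¬ ∃ a : G.edgeSet → ℝ, SymPacking.IsEdgeLengthEquilibriumStress C G p a) ∧
    (SymPacking.packingRigidityMatrix C G p r).rank = G.edgeFinset.card := by
  refine ⟨hP.wellPositioned hC, fun ⟨a, ha⟩ => hP.not_isEdgeLengthEquilibriumStress hC a ha, ?_⟩
  rw [(hP.linearIndependent_row hC).rank_matrix, SimpleGraph.edgeFinset_card]
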